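/- **Setting.** Fix a set $\mathsf{Prop}$ of proposition letters and a set $\mathsf{Gam}$ of atomic games. Formulas and game terms of game logic are given by $$\varphi ::= p \mid \neg\varphi \mid \varphi\wedge\varphi \mid \varphi\vee\varphi \mid \langle\alpha\rangle\varphi, \qquad \alpha ::= g \mid \alpha^d \mid \alpha\cup\alpha \mid \alpha\cap\alpha \mid \alpha;\alpha \mid \alpha^* \mid \alpha^\times \mid \varphi? \mid \varphi!$$ with $p\in\mathsf{Prop}$, $g\in\mathsf{Gam}$. A term is in *dual and negation normal form* (DNNF) if $^d$ is applied only to atomic games and $\neg$ only to proposition letters. A game model $(S,\gamma,\Upsilon)$ consists of a set $S$, a monotone neighbourhood frame $\gamma(g)$ on $S$ for each $g \in \mathsf{Gam}$, i.e. an up-closed family $\gamma(g)(s)\subseteq\mathcal P(S)$ for each $s\in S$, and a valuation $\Upsilon:\mathsf{Prop}\to\mathcal P(S)$. Formulas denote subsets of $S$ and game terms denote monotone neighbourhood frames on $S$ in the standard way: $s \models \langle\alpha\rangle\varphi$ iff $[\![\varphi]\!]$ is an $\alpha$-neighbourhood of $s$, $U \in (f;g)(s)$ iff $\{s' : U\in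 g(s')\}\in f(s)$, $U\in f^d(s)$ iff $S\setminus U\notin f(s)$, $\cup$ and $\cap$ are union and intersection, $f^*$ is the least fixpoint of $g\mapsto \eta\cup(f;g)$ and $f^\times$ the greatest fixpoint of $g\mapsto\eta\cap(f;g)$, where $U\in\eta(s)$ iff $s\in U$; $U$ is a $\varphi?$-neighbourhood of $s$ iff $s\models\varphi$ and $s\in U$, and a $\varphi!$-neighbourhood iff $s\models\varphi$ or $s\in U$. A *syntax graph* $\mathbb G=(V,E,L,\Omega)$ is a finite directed graph $(V,E)$ with a labelling $L$ of vertices by literals $p,\neg p$ (no successor), modalities $\langle g\rangle,\langle g^d\rangle$ (exactly one successor), $\wedge$ or $\vee$ (exactly two successors), and a partial priority function $\Omega:V\rightharpoonup\mathbb N$ that is defined on at least one vertex of every simple cycle. It is *pointed* if it has a designated initial vertex $v_I$. It is evaluated on a game model by the *acceptance game*, a parity game between $\exists$ and $\forall$: a position $(v,s)$ with $L(v)$ a literal is final and won by $\exists$ iff the literal is true at $s$; at $(v,s)$ with $L(v)=\vee$ (resp. $\wedge$) $\exists$ (resp. $\forall$) moves to $(w,s)$ for a successor $w$ of $v$; at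 $(v,s)$ with $L(v)=\langle g\rangle$ (resp. $\langle g^d\rangle$) $\exists$ (resp. $\forall$) chooses $U\in\gamma(g)(s)$ and then the other player chooses $t\in U$, leading to $(w,t)$ for the successor $w$ of $v$. A player who is stuck loses; position $(v,s)$ has priority $\Omega(v)$ if this is defined, all other positions have priority $0$, and an infinite play is won by $\exists$ iff the largest priority occurring infinitely often is even. For a pointed syntax graph, $\mathbb G\equiv\varphi$ means that for all game models and all states $s$, $\exists$ has a winning strategy from $(v_I,s)$ iff $s\models\varphi$. A *path* is a nonempty sequence of vertices with edges between consecutive ones; it is *simple* if no vertex is repeated; $\Omega(p)$ is the maximal priority on the path $p$. A *game logic graph* is a syntax graph in which $\Omega$ is injective and, writing $h_n$ for the vertex with $\Omega(h_n)=n$, the following hold for all $n\in\operatorname{ran}(\Omega)$, for some maps $l,r:\operatorname{ran}(\Omega)\to V$: - (parity) $L(h_n)=\vee$ if $n$ is odd and $L(h_n)=\wedge$ if $n$ is even; - (brexit) $E(h_n)=\{l_n,r_n\}$; - (leaving cycles) every simple path $p$ from $l_n$ to $h_n$ has $\Omega(p)>n$; - (no remain path to higher) there is no simple path $h_n r_n\cdots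 h_m$ with $m>n$. It is a *game logic graph with exit* $e\in\mathsf{Prop}$ if in addition no vertex is labelled $\neg e$ and, for the same maps, - (exit) for all $n\in\operatorname{ran}(\Omega)$ and all $v$ with $L(v)=e$ there is no simple path $h_n r_n\cdots v$. **Theorem.** (1) For every game term $\alpha$ in DNNF and every proposition letter $e$ that does not occur in $\alpha$, there is a pointed game logic graph $\mathbb G$ with exit $e$ such that $\mathbb G\equiv\langle\alpha\rangle e$. (2) For every formula $\varphi$ in DNNF there is a pointed game logic graph $\mathbb G$ such that $\mathbb G\equiv\varphi$. -/

import Mathlib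

universe u v w

noncomputable section

namespace GameLogic

/-! ### Syntax of game logic -/

mutual

/-- Formulas over proposition letters `P` and atomic games `A`. -/
inductive Formula (P : Type u) (A : Type v) : Type (max u v) where
  | atom : P → Formula P A
  | neg : Formula P A → Formula P A
  | and : Formula P A → Formula P A → Formula P A
  | or : Formula P A → Formula P A → Formula P A
  /-- `dia α φ` is `⟨α⟩φ`. -/
  | dia : GameTerm P A → Formula P A → Formula P A

/-- Game terms over proposition letters `P` and atomic games `A`. -/
inductive GameTerm (P : Type u) (A : Type v) : Type (max u v) where
  | atom : A → GameTerm P A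
  /-- The dual game `α^d`. -/
  | dual : GameTerm P A → GameTerm P A
  /-- Angelic choice `α ∪ β`. -/
  | angelChoice : GameTerm P A → GameTerm P A → GameTerm P A
  /-- Demonic choice `α ∩ β`. -/
  | demonChoice : GameTerm P A → GameTerm P A → GameTerm P A
  /-- Composition `α ; β`. -/
  | comp : GameTerm P A → GameTerm P A → GameTerm P A
  /-- Angelic iteration `α^*`. -/
  | angelIter : GameTerm P A → GameTerm P A
  /-- Demonic iteration `α^×`. -/
  | demonIter : GameTerm P A → GameTerm P A
  /-- Angelic test `φ?`. -/
  | angelTest : Formula P A → GameTerm P A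
  /-- Demonic test `φ!`. -/
  | demonTest : Formula P A → GameTerm P A

end

mutual

/-- The proposition letter `e` occurs in the formula. -/
def Formula.Occurs {P : Type u} {A : Type v} (e : P) : Formula P A → Prop
  | .atom p => p = e
  | .neg φ => φ.Occurs e
  | .and φ ψ => φ.Occurs e ∨ ψ.Occurs e
  | .or φ ψ => φ.Occurs e ∨ ψ.Occurs e
  | .dia α φ => α.Occurs e ∨ φ.Occurs e

/-- The proposition letter `e` occurs in the game term. -/
def GameTerm.Occurs {P : Type u} {A : Type v} (e : P) : GameTerm P A → Prop
  | .atom _ => False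
  | .dual α => α.Occurs e
  | .angelChoice α β => α.Occurs e ∨ β.Occurs e
  | .demonChoice α β => α.Occurs e ∨ β.Occurs e
  | .comp α β => α.Occurs e ∨ β.Occurs e
  | .angelIter α => α.Occurs e
  | .demonIter α => α.Occurs e
  | .angelTest φ => φ.Occurs e
  | .demonTest φ => φ.Occurs e

end

mutual

/-- Dual and negation normal form of formulas: negation is applied only to proposition letters,
and dual only to atomic games. -/
def Formula.DNNF {P : Type u} {A : Type v} : Formula P A → Prop
  | .atom _ => True
  | .neg φ => ∃ p, φ = .atom p
  | .and φ ψ => φ.DNNF ∧ ψ.DNNF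
  | .or φ ψ => φ.DNNF ∧ ψ.DNNF
  | .dia α φ => α.DNNF ∧ φ.DNNF

/-- Dual and negation normal form of game terms. -/
def GameTerm.DNNF {P : Type u} {A : Type v} : GameTerm P A → Prop
  | .atom _ => True
  | .dual α => ∃ g, α = .atom g
  | .angelChoice α β => α.DNNF ∧ β.DNNF
  | .demonChoice α β => α.DNNF ∧ β.DNNF
  | .comp α β => α.DNNF ∧ β.DNNF
  | .angelIter α => α.DNNF
  | .demonIter α => α.DNNF
  | .angelTest φ => φ.DNNF
  | .demonTest φ => φ.DNNF

end

/-! ### Monotone neighbourhood frames -/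

/-- Monotone neighbourhood frames on `S`. An up-closed family of subsets of `S` is given by its
monotone membership predicate, so that `f s U` says that `U` is a neighbourhood of `s`.
The order, with its joins and meets, is pointwise inclusion of families. -/
abbrev MF (S : Type w) : Type w := S → (Set S →o Prop)

namespace MF

variable {S : Type w}

/-- The unit frame: `U` is a neighbourhood of `s` iff `s ∈ U`. -/
def unit : MF S := fun s => ⟨fun U => s ∈ U, fun _ _ h hs => h hs⟩

/-- Composition: `U` is a neighbourhood of `s` iff `{s' | U ∈ g(s')} ∈ f(s)`. -/
def comp (f g : MF S) : MF S := fun s =>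
  ⟨fun U => f s {s' | g s' U}, fun _ _ h => (f s).mono fun s' hs' => (g s').mono h hs'⟩

/-- The dual frame: `U` is a neighbourhood of `s` iff the complement of `U` is not one for `f`. -/
def dual (f : MF S) : MF S := fun s =>
  ⟨fun U => ¬ f s Uᶜ, fun _ _ h hU hV => hU ((f s).mono (Set.compl_subset_compl.mpr h) hV)⟩

theorem comp_mono (f : MF S) {g h : MF S} (hgh : g ≤ h) : comp f g ≤ comp f h :=
  fun s U => (f s).mono fun s' hs' => hgh s' U hs'

/-- The map `g ↦ unit ∪ (f ; g)`. -/
def angelMap (f : MF S) : MF S →o MF S :=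
  ⟨fun g => unit ⊔ comp f g, fun _ _ h => sup_le_sup_left (comp_mono f h) _⟩

/-- The map `g ↦ unit ∩ (f ; g)`. -/
def demonMap (f : MF S) : MF S →o MF S :=
  ⟨fun g => unit ⊓ comp f g, fun _ _ h => inf_le_inf_left _ (comp_mono f h)⟩

/-- Angelic iteration. -/
def angelIter (f : MF S) : MF S := OrderHom.lfp (angelMap f)

/-- Demonic iteration. -/
def demonIter (f : MF S) : MF S := OrderHom.gfp (demonMap f)

/-- Angelic test: the unit on `X`, and no neighbourhoods outside `X`. -/
def angelTest (X : Set S) : MF S := fun s =>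
  ⟨fun U => s ∈ X ∧ s ∈ U, fun _ _ h hs => ⟨hs.1, h hs.2⟩⟩

/-- Demonic test: the unit outside `X`, and all subsets as neighbourhoods on `X`. -/
def demonTest (X : Set S) : MF S := fun s =>
  ⟨fun U => s ∈ X ∨ s ∈ U, fun _ _ h hs => hs.imp id fun k => h k⟩

end MF

/-- A game model on the set of states `S`. -/
structure GameModel (P : Type u) (A : Type v) (S : Type w) where
  /-- Interpretation of the atomic games. -/
  γ : A → MF S
  /-- Valuation of the proposition letters. -/
  val : P → Set S

mutual

/-- The set of states at which a formula is true. -/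
def Formula.sem {P : Type u} {A : Type v} {S : Type w} (M : GameModel P A S) :
    Formula P A → Set S
  | .atom p => M.val p
  | .neg φ => (φ.sem M)ᶜ
  | .and φ ψ => φ.sem M ∩ ψ.sem M
  | .or φ ψ => φ.sem M ∪ ψ.sem M
  | .dia α φ => {s | α.sem M s (φ.sem M)}

/-- The neighbourhood frame denoted by a game term. -/
def GameTerm.sem {P : Type u} {A : Type v} {S : Type w} (M : GameModel P A S) :
    GameTerm P A → MF S
  | .atom g => M.γ g
  | .dual α => MF.dual (α.sem M)
  | .angelChoice α β => α.sem M ⊔ β.sem M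
  | .demonChoice α β => α.sem M ⊓ β.sem M
  | .comp α β => MF.comp (α.sem M) (β.sem M)
  | .angelIter α => MF.angelIter (α.sem M)
  | .demonIter α => MF.demonIter (α.sem M)
  | .angelTest φ => MF.angelTest (φ.sem M)
  | .demonTest φ => MF.demonTest (φ.sem M)

end

/-! ### Parity games -/

/-- The two players. -/
inductive Player where
  | eloise
  | abelard

/-- A parity game with board `B`. -/
structure ParityGame (B : Type w) where
  /-- The player whose turn it is. -/
  owner : B → Player
  /-- The admissible moves. -/
  edge : B → B → Prop
  /-- The priorities. -/
  prio : B → ℕ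
  finite_range : (Set.range prio).Finite

namespace ParityGame

variable {B : Type w} (𝒢 : ParityGame B)

/-- A strategy for player `i` assigns to a finite sequence of positions that ends in a position
of `i` a legal next position, if there is one. (Values elsewhere are irrelevant.) -/
structure Strategy (i : Player) where
  /-- The choice of the next position. -/
  next : List B → B
  legal : ∀ (h : List B) (b : B), 𝒢.owner b = i → (∃ c, 𝒢.edge b c) →
    𝒢.edge b (next (h ++ [b]))

variable {𝒢}

/-- The nonempty finite sequence `l` is a play from `b₀` that follows the strategy `f`. -/
def Strategy.FinPlay {i : Player} (f : 𝒢.Strategy i) (b₀ : B) (l : List B) : Prop :=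
  l.head? = some b₀ ∧ l.IsChain 𝒢.edge ∧
    ∀ (h : List B) (b c : B) (t : List B), l = h ++ b :: c :: t → 𝒢.owner b = i →
      c = f.next (h ++ [b])

/-- The infinite sequence `π` is a play from `b₀` that follows the strategy `f`. -/
def Strategy.InfPlay {i : Player} (f : 𝒢.Strategy i) (b₀ : B) (π : ℕ → B) : Prop :=
  π 0 = b₀ ∧ (∀ n, 𝒢.edge (π n) (π (n + 1))) ∧
    ∀ n, 𝒢.owner (π n) = i → π (n + 1) = f.next ((List.range (n + 1)).map π)

variable (𝒢)

/-- Eloise wins the infinite play `π` iff the largest priority that occurs infinitely often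
on it is even. -/
def EloiseWins (π : ℕ → B) : Prop :=
  ∃ k, IsGreatest {m : ℕ | ∃ᶠ n in Filter.atTop, 𝒢.prio (π n) = m} k ∧ Even k

/-- The player `i` wins the infinite play `π`. -/
def WinsInf : Player → (ℕ → B) → Prop
  | .eloise, π => 𝒢.EloiseWins π
  | .abelard, π => ¬ 𝒢.EloiseWins π

variable {𝒢}

/-- The strategy `f` of player `i` is winning from `b₀`: no play from `b₀` that follows `f` ends
in a position at which `i` is stuck, and `i` wins all infinite plays from `b₀` that
follow `f`. -/
def Strategy.IsWinning {i : Player} (f : 𝒢.Strategy i) (b₀ : B) : Prop :=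
  (∀ (l : List B) (b : B), f.FinPlay b₀ (l ++ [b]) → (∀ c, ¬ 𝒢.edge b c) → 𝒢.owner b ≠ i) ∧
    ∀ π : ℕ → B, f.InfPlay b₀ π → 𝒢.WinsInf i π

variable (𝒢)

/-- The set of winning positions of player `i`. -/
def win (i : Player) : Set B := {b | ∃ f : 𝒢.Strategy i, f.IsWinning b}

end ParityGame

/-! ### Syntax graphs -/

/-- Vertex labels of syntax graphs. -/
inductive Label (P : Type u) (A : Type v) : Type (max u v) where
  /-- The literal `p`. -/
  | pos : P → Label P A
  /-- The literal `¬ p`. -/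
  | neg : P → Label P A
  /-- The modality `⟨g⟩`. -/
  | dia : A → Label P A
  /-- The modality `⟨g^d⟩`. -/
  | diaDual : A → Label P A
  | and : Label P A
  | or : Label P A

/-- The number of successors of a vertex with the given label. -/
def Label.arity {P : Type u} {A : Type v} : Label P A → ℕ
  | .pos _ => 0
  | .neg _ => 0
  | .dia _ => 1
  | .diaDual _ => 1
  | .and => 2
  | .or => 2

/-- A simple path in a graph: a nonempty path without repeated vertices. -/
def IsSimplePath {V : Type} (E : V → V → Prop) (p : List V) : Prop :=
  p ≠ [] ∧ p.IsChain E ∧ p.Nodup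

/-- A simple cycle, listed without repeating its first vertex at the end. -/
def IsSimpleCycle {V : Type} (E : V → V → Prop) (p : List V) : Prop :=
  IsSimplePath E p ∧ ∃ x ∈ p.getLast?, ∃ y ∈ p.head?, E x y

/-- A (finite) syntax graph. -/
structure SyntaxGraph (P : Type u) (A : Type v) where
  /-- The vertices. -/
  V : Type
  finite : Finite V
  /-- The edges. -/
  E : V → V → Prop
  /-- The labels. -/
  L : V → Label P A
  /-- The partial priority function. -/
  Ω : V → Option ℕ
  arity_cond : ∀ v, {x | E v x}.ncard = (L v).arity
  priority_cond : ∀ p : List V, IsSimpleCycle E p → ∃ x ∈ p, (Ω x).isSome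

namespace SyntaxGraph

variable {P : Type u} {A : Type v} (𝔾 : SyntaxGraph P A)

/-- Positions of the acceptance game: `state x s` is the pair of a vertex and a state, and
`nbhd x U` is the pair of a vertex and a set of states (for vertices with a modal label). -/
inductive Position (S : Type w) : Type w where
  | state : 𝔾.V → S → Position S
  | nbhd : 𝔾.V → Set S → Position S

/-- The vertex carries a modal label, for the atomic game `g` or its dual. -/
def Modal (x : 𝔾.V) (g : A) : Prop := 𝔾.L x = .dia g ∨ 𝔾.L x = .diaDual g

open Classical in
/-- Whose turn it is in the acceptance game. -/
def owner {S : Type w} (M : GameModel P A S) : 𝔾.Position S → Player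
  | .state x s =>
    match 𝔾.L x with
    | .pos p => if s ∈ M.val p then .abelard else .eloise
    | .neg p => if s ∈ M.val p then .eloise else .abelard
    | .dia _ => .eloise
    | .diaDual _ => .abelard
    | .and => .abelard
    | .or => .eloise
  | .nbhd x _ =>
    match 𝔾.L x with
    | .diaDual _ => .eloise
    | _ => .abelard

/-- The moves of the acceptance game. At `(x, s)` with a Boolean label the pebble moves to
`(y, s)` for a successor `y` of `x`. At `(x, s)` with a modal label for `g` or `g^d` it moves to
`(x, U)` for a neighbourhood `U` in `γ(g)(s)`, and from there to `(y, t)` for the successor `y` of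
`x` and some `t ∈ U`. -/
def move {S : Type w} (M : GameModel P A S) : 𝔾.Position S → 𝔾.Position S → Prop
  | .state x s, .state y t => (𝔾.L x = .and ∨ 𝔾.L x = .or) ∧ 𝔾.E x y ∧ t = s
  | .state x s, .nbhd y U => y = x ∧ ∃ g, 𝔾.Modal x g ∧ M.γ g s U
  | .nbhd x U, .state y t => (∃ g, 𝔾.Modal x g) ∧ 𝔾.E x y ∧ t ∈ U
  | .nbhd _ _, .nbhd _ _ => False

/-- Priorities of the acceptance game. -/
def posPrio {S : Type w} : 𝔾.Position S → ℕ
  | .state x _ => (𝔾.Ω x).getD 0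
  | .nbhd _ _ => 0

theorem finite_range_posPrio {S : Type w} : (Set.range (𝔾.posPrio (S := S))).Finite := by
  have := 𝔾.finite
  refine ((Set.finite_range fun x => (𝔾.Ω x).getD 0).union (Set.finite_singleton 0)).subset ?_
  rintro _ ⟨b, rfl⟩
  cases b with
  | state x s => exact Or.inl ⟨x, rfl⟩
  | nbhd x U => exact Or.inr rfl

/-- The acceptance game of a syntax graph on a game model. -/
def acceptanceGame {S : Type w} (M : GameModel P A S) : ParityGame (𝔾.Position S) where
  owner := 𝔾.owner M
  edge := 𝔾.move M
  prio := 𝔾.posPrio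
  finite_range := 𝔾.finite_range_posPrio

/-- The graph, started at the vertex `vI`, is equivalent to the formula `φ`: in all game models
(with states in a given universe) and all states `s`, Eloise wins the acceptance game from
`(vI, s)` iff `φ` is true at `s`. -/
def Equivalent (vI : 𝔾.V) (φ : Formula P A) : Prop :=
  ∀ (S : Type w) (M : GameModel P A S) (s : S),
    .state vI s ∈ (𝔾.acceptanceGame M).win .eloise ↔ s ∈ φ.sem M

/-! ### Game logic graphs -/

/-- The range of the priority function. -/
def PrioRange : Type := {n : ℕ // ∃ x, 𝔾.Ω x = some n}

variable {𝔾}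

/-- The priority `n` as a natural number. -/
def PrioRange.val (n : 𝔾.PrioRange) : ℕ := n.1

/-- The head of priority `n`: the vertex of this priority (unique if `Ω` is injective). -/
def head (n : 𝔾.PrioRange) : 𝔾.V := n.2.choose

theorem prio_head (n : 𝔾.PrioRange) : 𝔾.Ω (head n) = some n.val := n.2.choose_spec

variable (𝔾)

/-- The priority of a path: the maximum of the priorities on it, and `⊥` if there is none. -/
def pathPrio (p : List 𝔾.V) : WithBot ℕ := (p.filterMap 𝔾.Ω).maximum

/-- The priority function is injective (on its domain). -/
def InjectivePrio : Prop := ∀ x y n, 𝔾.Ω x = some n → 𝔾.Ω y = some n → x = y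

/-- Heads of odd priority are labelled with a disjunction, heads of even priority with a
conjunction. -/
def Parity : Prop :=
  ∀ n : 𝔾.PrioRange, (Odd n.val → 𝔾.L (head n) = .or) ∧ (Even n.val → 𝔾.L (head n) = .and)

/-- The maps `l` and `r` choose the leaving and the remaining successor of each head: the
successors of `h_n` are `l_n` and `r_n`; all simple paths from `l_n` to `h_n` have a priority
larger than `n`; and there is no simple path that starts with `h_n r_n` and ends in a head of
priority larger than `n`. -/
def Brexit (l r : 𝔾.PrioRange → 𝔾.V) : Prop :=
  ∀ n : 𝔾.PrioRange,
    {x | 𝔾.E (head n) x} = {l n, r n} ∧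
    (∀ p : List 𝔾.V, IsSimplePath 𝔾.E p → p.head? = some (l n) → p.getLast? = some (head n) →
      (n.val : WithBot ℕ) < 𝔾.pathPrio p) ∧
    (∀ m : 𝔾.PrioRange, n.val < m.val → ¬ ∃ q : List 𝔾.V,
      IsSimplePath 𝔾.E (head n :: r n :: q) ∧
        (head n :: r n :: q).getLast? = some (head m))

/-- There is no simple path that starts with `h_n r_n` and ends in a vertex labelled `e`. -/
def ExitCond (e : P) (r : 𝔾.PrioRange → 𝔾.V) : Prop :=
  ∀ (n : 𝔾.PrioRange) (x : 𝔾.V), 𝔾.L x = .pos e → ¬ ∃ q : List 𝔾.V,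
    IsSimplePath 𝔾.E (head n :: r n :: q) ∧ (head n :: r n :: q).getLast? = some x

/-- Game logic graphs. -/
def IsGameLogicGraph : Prop :=
  𝔾.InjectivePrio ∧ 𝔾.Parity ∧ ∃ l r : 𝔾.PrioRange → 𝔾.V, 𝔾.Brexit l r

/-- Game logic graphs with exit `e`. The exit is a proposition letter whose negation does not
occur as a label. -/
def IsGameLogicGraphWithExit (e : P) : Prop :=
  (∀ x, 𝔾.L x ≠ .neg e) ∧ 𝔾.InjectivePrio ∧ 𝔾.Parity ∧
    ∃ l r : 𝔾.PrioRange → 𝔾.V, 𝔾.Brexit l r ∧ 𝔾.ExitCond e r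

end SyntaxGraph

/-- A syntax graph with an initial vertex. -/
structure PointedSyntaxGraph (P : Type u) (A : Type v) extends SyntaxGraph P A where
  /-- The initial vertex. -/
  vI : V

namespace PointedSyntaxGraph

variable {P : Type u} {A : Type v}

/-- Equivalence of a pointed syntax graph and a formula. -/
def Equivalent (𝔾 : PointedSyntaxGraph P A) (φ : Formula P A) : Prop :=
  SyntaxGraph.Equivalent.{u, v, w} 𝔾.toSyntaxGraph 𝔾.vI φ

end PointedSyntaxGraph

end GameLogic

end

/-!
The graph of a game term is built by recursion on the term, as a graph with an open end: an
additional vertex, the exit, at which the game denoted by the term is over. Composition identifies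
the exit of one graph with the initial vertex of the other; iteration adds a head, with a priority
of the right parity above all those of the graph, at which the controlling player either leaves to
the exit or plays the graph once more and so returns to the head. A formula is represented in the
same way, by a graph whose exit is never reached. Then `⟨α⟩φ` is a composition, and a test is a
choice between the formula and the exit. In the end the exit becomes a vertex labelled `e`.

*Structure.* The conditions on heads say that certain vertices cannot be reached. They are carried
along by witnesses: a closed set of vertices that contains the starting point and misses the target
(`OpenGraph.HeadCond`). Such witnesses are transported by embeddings of graphs
(`OpenGraph.HeadCond.map`). The decisive facts are that the remaining successor of a head does not
reach the exit without returning to the head, so that gluing something to the exit does not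
matter to it, and that the new head of an iteration has the largest priority.

*Semantics.* For each player, one shows that the player can force everything that the denoted frame,
or its dual for Abelard, promises (`OpenGraph.Realizes`). As the two players cannot both win
(`ParityGame.not_mem_win_both`), this gives the equivalence. What can be forced is expressed by
strategies with memory that may end in a set of exits (`ParityGame.Tableau`). These are closed under
composition (`ParityGame.forces_trans`) and under unbounded repetition
(`ParityGame.loop_subset_forces`), and yield strategies in the proper sense
(`ParityGame.mem_win_of_mem_forces`). In an iteration, the states from which the controlling player
wins at the head form a prefixed point, hence contain the least one; the other player has a
postfixed point and may return to the head for ever. So neither ordinal ranks of least fixpoints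
nor positional determinacy are needed.
-/

namespace GameLogic

/-! ### Strategies with memory in parity games -/

namespace ParityGame

open Filter

variable {B : Type w} {C : Type w}

theorem eloiseWins_congr {𝒢 : ParityGame B} {ℋ : ParityGame C} {π : ℕ → B} {ρ : ℕ → C}
    (h : ∀ n, 𝒢.prio (π n) = ℋ.prio (ρ n)) : 𝒢.EloiseWins π ↔ ℋ.EloiseWins ρ := by
  simp only [EloiseWins, h]

theorem winsInf_congr {𝒢 : ParityGame B} {ℋ : ParityGame C} {i : Player} {π : ℕ → B} {ρ : ℕ → C}
    (h : ∀ n, 𝒢.prio (π n) = ℋ.prio (ρ n)) : 𝒢.WinsInf i π ↔ ℋ.WinsInf i ρ := by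
  cases i with
  | eloise => exact eloiseWins_congr h
  | abelard => exact not_congr (eloiseWins_congr h)

variable (𝒢 : ParityGame B)

theorem eloiseWins_shift (π : ℕ → B) (m : ℕ) :
    𝒢.EloiseWins (fun n => π (n + m)) ↔ 𝒢.EloiseWins π := by
  have (k : ℕ) : (∃ᶠ n in atTop, 𝒢.prio (π (n + m)) = k) ↔ ∃ᶠ n in atTop, 𝒢.prio (π n) = k := by
    conv_rhs => rw [← map_add_atTop_eq_nat m, frequently_map]
  simp only [EloiseWins, this]

theorem winsInf_shift (i : Player) (π : ℕ → B) (m : ℕ) :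
    𝒢.WinsInf i (fun n => π (n + m)) ↔ 𝒢.WinsInf i π := by
  cases i with
  | eloise => exact 𝒢.eloiseWins_shift π m
  | abelard => exact not_congr (𝒢.eloiseWins_shift π m)

/-- The parity that player `i` wants the dominating priority to have. -/
def GoodPrio : Player → ℕ → Prop
  | .eloise, n => Even n
  | .abelard, n => Odd n

variable {𝒢}

theorem winsInf_of_frequently {i : Player} {π : ℕ → B} {N : ℕ} (hN : GoodPrio i N)
    (hle : ∀ n, 𝒢.prio (π n) ≤ N) (hfreq : ∃ᶠ n in atTop, 𝒢.prio (π n) = N) :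
    𝒢.WinsInf i π := by
  have hg : IsGreatest {m : ℕ | ∃ᶠ n in atTop, 𝒢.prio (π n) = m} N := by
    refine ⟨hfreq, fun m hm => ?_⟩
    obtain ⟨n, hn⟩ := hm.exists
    exact hn ▸ hle n
  cases i with
  | eloise => exact ⟨N, hg, hN⟩
  | abelard =>
    rintro ⟨k, hk, hev⟩
    rw [hk.unique hg] at hev
    exact (Nat.not_even_iff_odd.mpr hN) hev

variable (𝒢)

/-- Player `i` can make sure that the position after `b` lies in `Z`, and is not stuck at `b`. -/
def Step (i : Player) (b : B) (Z : Set B) : Prop :=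
  (𝒢.owner b = i → ∃ c ∈ Z, 𝒢.edge b c) ∧ (𝒢.owner b ≠ i → ∀ c, 𝒢.edge b c → c ∈ Z)

variable {𝒢}

theorem Step.mono {i : Player} {b : B} {Z Z' : Set B} (h : 𝒢.Step i b Z) (hZ : Z ⊆ Z') :
    𝒢.Step i b Z' :=
  ⟨fun ho => let ⟨c, hc, he⟩ := h.1 ho; ⟨c, hZ hc, he⟩, fun ho c he => hZ (h.2 ho c he)⟩

variable (𝒢)

/-- A strategy of player `i` with memory, for reaching one of the exits `X` or else winning, while
all positions before the exit lie in `I`. The memory states `N` are labelled by positions; from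
each of them `i` can force the next position to be an exit, or the label of a memory state related
by `T`. An exit ends the play even if it lies in `I`. -/
structure Tableau (i : Player) (I X : Set B) where
  /-- The memory states. -/
  N : Type w
  /-- The current position. -/
  pos : N → B
  /-- The transitions between memory states. -/
  T : N → N → Prop
  interior : ∀ n, pos n ∈ I
  step : ∀ n, 𝒢.Step i (pos n) (X ∪ {c | ∃ n', T n n' ∧ pos n' = c})
  wins : ∀ π : ℕ → N, (∀ k, T (π k) (π (k + 1))) → 𝒢.WinsInf i (fun k => pos (π k))

/-- The positions from which player `i`, playing inside `I` for at least one move, can reach `X`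
or win. -/
def StrictForces (i : Player) (I X : Set B) : Set B :=
  {b | ∃ (t : 𝒢.Tableau i I X) (n : t.N), t.pos n = b}

/-- The positions from which player `i`, playing inside `I`, can reach `X` or win. -/
def Forces (i : Player) (I X : Set B) : Set B := X ∪ 𝒢.StrictForces i I X

variable {𝒢} {i : Player} {I X Y D : Set B}

/-- A family of tableaux is glued into one: `J k k' n'` says that a play which leaves the tableau
`k` may continue in the memory state `n'` of the tableau `k'`. -/
def Tableau.glue {K : Type w} {X : K → Set B} (t : ∀ k, 𝒢.Tableau i I (X k))
    (J : ∀ _ k' : K, (t k').N → Prop)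
    (hX : ∀ k, ∀ x ∈ X k, x ∈ Y ∨ ∃ k' n', J k k' n' ∧ (t k').pos n' = x)
    (hw : ∀ π : ℕ → Σ k, (t k).N,
      (∀ j, (π j).1 = (π (j + 1)).1 ∨ J (π j).1 (π (j + 1)).1 (π (j + 1)).2) →
      (∃ᶠ j in atTop, J (π j).1 (π (j + 1)).1 (π (j + 1)).2) →
      𝒢.WinsInf i (fun j => (t (π j).1).pos (π j).2)) : 𝒢.Tableau i I Y where
  N := Σ k, (t k).N
  pos p := (t p.1).pos p.2
  T p q := (∃ k n n', p = ⟨k, n⟩ ∧ q = ⟨k, n'⟩ ∧ (t k).T n n') ∨ J p.1 q.1 q.2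
  interior p := (t p.1).interior p.2
  step p := by
    refine ((t p.1).step p.2).mono ?_
    rintro c (hc | ⟨n', hT, rfl⟩)
    · rcases hX _ _ hc with h | ⟨k', n', hJ, rfl⟩
      · exact Or.inl h
      · exact Or.inr ⟨⟨k', n'⟩, Or.inr hJ, rfl⟩
    · exact Or.inr ⟨⟨p.1, n'⟩, Or.inl ⟨p.1, p.2, n', rfl, rfl, hT⟩, rfl⟩
  wins π hπ := by
    by_cases hf : ∃ᶠ j in atTop, J (π j).1 (π (j + 1)).1 (π (j + 1)).2
    · refine hw π (fun j => ?_) hf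
      rcases hπ j with ⟨k, n, n', h1, h2, -⟩ | h
      · exact Or.inl (by rw [h1, h2])
      · exact Or.inr h
    · -- From some point on, the play stays in a single tableau, which is winning.
      obtain ⟨m, hm⟩ := eventually_atTop.mp (not_frequently.mp hf)
      have key : ∀ j, ∃ n, π (j + m) = ⟨(π m).1, n⟩ := by
        intro j
        induction j with
        | zero => exact ⟨(π m).2, by simp⟩
        | succ j ih =>
          obtain ⟨n, hn⟩ := ih
          rcases hπ (j + m) with ⟨k, n₁, n₂, h1, h2, -⟩ | h
          · rw [hn] at h1
            obtain rfl : (π m).1 = k := congrArg Sigma.fst h1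
            exact ⟨n₂, by rw [← h2]; congr 1; omega⟩
          · exact absurd h (hm _ (by omega))
      choose ρ hρ using key
      have hT : ∀ j, (t (π m).1).T (ρ j) (ρ (j + 1)) := by
        intro j
        rcases hπ (j + m) with ⟨k, n₁, n₂, h1, h2, h3⟩ | h
        · have e2 : π (j + m + 1) = ⟨(π m).1, ρ (j + 1)⟩ := by
            rw [← hρ (j + 1)]; congr 1; omega
          rw [hρ j] at h1
          rw [e2] at h2
          obtain rfl : (π m).1 = k := congrArg Sigma.fst h1
          obtain rfl := eq_of_heq (Sigma.mk.inj h1).2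
          obtain rfl := eq_of_heq (Sigma.mk.inj h2).2
          exact h3
        · exact absurd h (hm _ (by omega))
      rw [← winsInf_shift _ _ _ m]
      refine (winsInf_congr fun j => ?_).mp ((t (π m).1).wins ρ hT)
      rw [hρ j]

theorem strictForces_trans (hXY : X ⊆ 𝒢.Forces i I Y) :
    𝒢.StrictForces i I X ⊆ 𝒢.StrictForces i I Y := by
  rintro b ⟨t₀, n₀, rfl⟩
  choose t r hr using fun x : 𝒢.StrictForces i I Y => x.2
  let Z : Option (𝒢.StrictForces i I Y) → Set B := fun k => k.elim X fun _ => Y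
  let tt : ∀ k, 𝒢.Tableau i I (Z k) := fun k =>
    match k with
    | none => t₀
    | some x => t x
  refine ⟨Tableau.glue tt
    (fun k k' n' => k = none ∧ ∃ x, k' = some x ∧ (tt k').pos n' = x.1) ?_ ?_, ⟨none, n₀⟩, rfl⟩
  · rintro (_ | k) x hx
    · rcases hXY hx with h | h
      · exact Or.inl h
      · exact Or.inr ⟨some ⟨x, h⟩, r ⟨x, h⟩, ⟨rfl, _, rfl, hr ⟨x, h⟩⟩, hr ⟨x, h⟩⟩
    · exact Or.inl hx
  · -- A second change of tableaux would have to start from the first one again.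
    intro π hπ hf
    exfalso
    obtain ⟨j, -, x, hx, -⟩ := hf.exists
    have hsome : ∀ l, (π (l + (j + 1))).1 ≠ none := by
      intro l
      induction l with
      | zero => simp [hx]
      | succ l ih =>
        rcases hπ (l + (j + 1)) with h | ⟨h, -⟩
        · rw [show l + 1 + (j + 1) = l + (j + 1) + 1 by omega, ← h]; exact ih
        · exact absurd h ih
    obtain ⟨l, hl, h, -⟩ := (frequently_atTop.mp hf) (j + 1)
    obtain ⟨d, rfl⟩ := Nat.exists_eq_add_of_le' hl
    exact hsome d h

theorem forces_trans (hXY : X ⊆ 𝒢.Forces i I Y) : 𝒢.Forces i I X ⊆ 𝒢.Forces i I Y := by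
  rintro b (hb | hb)
  · exact hXY hb
  · exact Or.inr (strictForces_trans hXY hb)

theorem strictForces_of_step {b : B} (hb : b ∈ I) (h : 𝒢.Step i b (𝒢.Forces i I X)) :
    b ∈ 𝒢.StrictForces i I X := by
  refine strictForces_trans (X := 𝒢.Forces i I X) subset_rfl
    ⟨⟨PUnit, fun _ => b, fun _ _ => False, fun _ => hb, fun _ => h.mono Set.subset_union_left,
      fun π hπ => (hπ 0).elim⟩, PUnit.unit, rfl⟩

theorem forces_of_step {b : B} (hb : b ∈ I) (h : 𝒢.Step i b (𝒢.Forces i I X)) :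
    b ∈ 𝒢.Forces i I X :=
  Or.inr (strictForces_of_step hb h)

/-- If player `i` can return from `D` to `D` again and again, and doing so forever is winning, then
`i` wins from `D`. -/
theorem loop_subset_forces (hD : D ⊆ 𝒢.StrictForces i I (X ∪ D))
    (hw : ∀ π : ℕ → B, (∀ n, π n ∈ I) → (∃ᶠ n in atTop, π n ∈ D) → 𝒢.WinsInf i π) :
    D ⊆ 𝒢.Forces i I X := by
  intro b hb
  choose t r hr using fun x : D => hD x.2
  refine Or.inr ⟨Tableau.glue t (fun _ k' n' => (t k').pos n' = k'.1) ?_ ?_,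
    ⟨⟨b, hb⟩, r ⟨b, hb⟩⟩, hr ⟨b, hb⟩⟩
  · rintro k x (hx | hx)
    · exact Or.inl hx
    · exact Or.inr ⟨⟨x, hx⟩, r ⟨x, hx⟩, hr ⟨x, hx⟩, hr ⟨x, hx⟩⟩
  · intro π _ hf
    refine hw _ (fun n => (t _).interior _) ?_
    rw [frequently_atTop] at hf ⊢
    intro a
    obtain ⟨j, hj, h⟩ := hf a
    exact ⟨j + 1, by omega, h ▸ (π (j + 1)).1.2⟩

/-- Forcing is transported along maps of boards that are bounded morphisms on `I`. -/
theorem forces_image {ℋ : ParityGame C} {I' : Set C} (f : B → C)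
    (hI : ∀ b ∈ I, f b ∈ I') (howner : ∀ b ∈ I, ℋ.owner (f b) = 𝒢.owner b)
    (hprio : ∀ b ∈ I, ℋ.prio (f b) = 𝒢.prio b)
    (hedge : ∀ b ∈ I, ∀ c', ℋ.edge (f b) c' ↔ ∃ c, 𝒢.edge b c ∧ f c = c')
    {b : B} (hb : b ∈ 𝒢.Forces i I X) : f b ∈ ℋ.Forces i I' (f '' X) := by
  rcases hb with hb | ⟨t, n, rfl⟩
  · exact Or.inl ⟨b, hb, rfl⟩
  · refine Or.inr ⟨⟨t.N, fun n => f (t.pos n), t.T, fun n => hI _ (t.interior n), fun n => ?_,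
      fun π hπ => (winsInf_congr fun k => ?_).mp (t.wins π hπ)⟩, n, rfl⟩
    · have key : ∀ c ∈ X ∪ {c | ∃ n', t.T n n' ∧ t.pos n' = c},
          f c ∈ f '' X ∪ {c | ∃ n', t.T n n' ∧ f (t.pos n') = c} := by
        rintro c (hc | ⟨n', hT, rfl⟩)
        · exact Or.inl ⟨c, hc, rfl⟩
        · exact Or.inr ⟨n', hT, rfl⟩
      have hn := t.interior n
      refine ⟨fun ho => ?_, fun ho c' hc' => ?_⟩
      · rw [howner _ hn] at ho
        obtain ⟨c, hc, he⟩ := (t.step n).1 ho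
        exact ⟨f c, key c hc, (hedge _ hn _).mpr ⟨c, he, rfl⟩⟩
      · rw [howner _ hn] at ho
        obtain ⟨c, hc, rfl⟩ := (hedge _ hn _).mp hc'
        exact key c ((t.step n).2 ho c hc)
    · exact (hprio _ (t.interior _)).symm

/-! ### From strategies with memory to strategies -/

namespace Tableau

variable (t : 𝒢.Tableau i Set.univ ∅) (n₀ : t.N)

open Classical in
/-- The memory state after the history `l`, if the first position of `l` is put down to the memory
state `n₀`. -/
noncomputable def track (l : List B) : Option t.N :=
  l.foldl (fun o c => some (o.elim n₀ fun n =>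
    if h : ∃ n', t.T n n' ∧ t.pos n' = c then h.choose else n)) none

theorem track_append {l : List B} {n : t.N} (hl : t.track n₀ l = some n) {c : B}
    (h : ∃ n', t.T n n' ∧ t.pos n' = c) :
    ∃ n', t.track n₀ (l ++ [c]) = some n' ∧ t.T n n' ∧ t.pos n' = c := by
  refine ⟨h.choose, ?_, h.choose_spec⟩
  unfold track at hl ⊢
  rw [List.foldl_append, hl]
  simp [h]

open Classical in
/-- The strategy that keeps track of the memory state. -/
noncomputable def toStrategy : 𝒢.Strategy i where
  next l :=
    if h : ∃ c, (∃ b ∈ l.getLast?, 𝒢.edge b c) ∧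
      ∃ n ∈ t.track n₀ l, ∃ n', t.T n n' ∧ t.pos n' = c then h.choose
    else if h : ∃ c, ∃ b ∈ l.getLast?, 𝒢.edge b c then h.choose
    else t.pos n₀
  legal l b _ hb := by
    obtain ⟨c, hc⟩ := hb
    have h : ∃ c, ∃ b' ∈ (l ++ [b]).getLast?, 𝒢.edge b' c := ⟨c, b, by simp, hc⟩
    split_ifs with h1
    · simpa using h1.choose_spec.1
    · simpa using h.choose_spec

theorem toStrategy_next {l : List B} {n : t.N} (hl : t.track n₀ l = some n)
    (hlast : l.getLast? = some (t.pos n)) (ho : 𝒢.owner (t.pos n) = i) :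
    ∃ n', t.T n n' ∧ t.pos n' = (t.toStrategy n₀).next l := by
  obtain ⟨c, hc, he⟩ := (t.step n).1 ho
  have h : ∃ c, (∃ b ∈ l.getLast?, 𝒢.edge b c) ∧
      ∃ n ∈ t.track n₀ l, ∃ n', t.T n n' ∧ t.pos n' = c :=
    ⟨c, ⟨_, hlast, he⟩, n, hl, by simpa using hc⟩
  have h2 := h.choose_spec.2
  have h3 : (t.toStrategy n₀).next l = h.choose := dif_pos h
  obtain ⟨m, hm, h4⟩ := h2
  obtain rfl : n = m := Option.some.inj (hl.symm.trans hm)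
  rw [h3]
  exact h4

/-- Along plays that follow the strategy, the memory state is labelled by the current position. -/
theorem track_next {l : List B} {n : t.N} (hl : t.track n₀ l = some n)
    (hlast : l.getLast? = some (t.pos n)) {c : B} (hc : 𝒢.edge (t.pos n) c)
    (ho : 𝒢.owner (t.pos n) = i → c = (t.toStrategy n₀).next l) :
    ∃ n', t.track n₀ (l ++ [c]) = some n' ∧ t.T n n' ∧ t.pos n' = c := by
  apply track_append t n₀ hl
  by_cases h : 𝒢.owner (t.pos n) = i
  · rw [ho h]
    exact toStrategy_next t n₀ hl hlast h
  · simpa using (t.step n).2 h c hc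

theorem toStrategy_isWinning : (t.toStrategy n₀).IsWinning (t.pos n₀) := by
  constructor
  · intro l b hlb hstuck ho
    have key : ∀ (l : List B) (b : B), (t.toStrategy n₀).FinPlay (t.pos n₀) (l ++ [b]) →
        ∃ n, t.track n₀ (l ++ [b]) = some n ∧ t.pos n = b := by
      intro l
      induction l using List.reverseRecOn with
      | nil =>
        rintro b ⟨h, -, -⟩
        exact ⟨n₀, rfl, by simpa using h.symm⟩
      | append_singleton l a ih =>
        rintro b ⟨h1, h2, h3⟩
        obtain ⟨n, hn, rfl⟩ := ih a ⟨by cases l <;> simpa using h1,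
          (List.isChain_append.mp h2).1, fun h x y s hs ho => h3 h x y (s ++ [b]) (by simp [hs]) ho⟩
        obtain ⟨n', h4, -, h5⟩ := track_next t n₀ hn (by simp) (c := b)
          ((List.isChain_append.mp h2).2.2 _ (by simp) _ (by simp))
          (h3 l (t.pos n) b [] (by simp))
        exact ⟨n', h4, h5⟩
    obtain ⟨n, -, rfl⟩ := key l b hlb
    obtain ⟨c, -, he⟩ := (t.step n).1 ho
    exact hstuck c he
  · rintro π ⟨h0, hE, hf⟩
    have hstep : ∀ k n, t.track n₀ ((List.range (k + 1)).map π) = some n → t.pos n = π k →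
        ∃ n', t.track n₀ ((List.range (k + 2)).map π) = some n' ∧ t.T n n' ∧
          t.pos n' = π (k + 1) := by
      intro k n hn hp
      rw [List.range_succ (n := k + 1), List.map_append]
      exact track_next t n₀ hn (by rw [hp]; simp [List.range_succ]) (hp ▸ hE k)
        (fun ho => hf k (hp ▸ ho))
    have key : ∀ k, ∃ n, t.track n₀ ((List.range (k + 1)).map π) = some n ∧ t.pos n = π k := by
      intro k
      induction k with
      | zero => exact ⟨n₀, rfl, h0.symm⟩
      | succ k ih =>
        obtain ⟨n, hn, hp⟩ := ih
        obtain ⟨n', h1, -, h2⟩ := hstep k n hn hp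
        exact ⟨n', h1, h2⟩
    choose ρ hρ hp using key
    have hT : ∀ k, t.T (ρ k) (ρ (k + 1)) := by
      intro k
      obtain ⟨n', h1, h2, -⟩ := hstep k (ρ k) (hρ k) (hp k)
      rw [hρ (k + 1)] at h1
      exact Option.some.inj h1 ▸ h2
    exact (winsInf_congr fun k => by rw [hp k]).mp (t.wins ρ hT)

end Tableau

theorem mem_win_of_mem_forces {b : B} (hb : b ∈ 𝒢.Forces i Set.univ ∅) : b ∈ 𝒢.win i := by
  rcases hb with hb | ⟨t, n, rfl⟩
  · exact hb.elim
  · exact ⟨t.toStrategy n, t.toStrategy_isWinning n⟩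

/-- The players do not both win: otherwise let their winning strategies play against each other. -/
theorem not_mem_win_both {b : B} (he : b ∈ 𝒢.win .eloise) (ha : b ∈ 𝒢.win .abelard) : False := by
  obtain ⟨f, hf⟩ := he
  obtain ⟨g, hg⟩ := ha
  let nxt : List B → B → B := fun h b =>
    match 𝒢.owner b with
    | .eloise => f.next (h ++ [b])
    | .abelard => g.next (h ++ [b])
  -- The play so far, without and with the current position.
  let H : ℕ → List B × B := fun n =>
    n.rec ([], b) fun _ p => (p.1 ++ [p.2], nxt p.1 p.2)
  let π : ℕ → B := fun n => (H n).2
  have hH : ∀ n, (H n).1 = (List.range n).map π := by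
    intro n
    induction n with
    | zero => rfl
    | succ n ih =>
      rw [List.range_succ, List.map_append, ← ih]
      rfl
  have hnext : ∀ n, π (n + 1) = nxt ((List.range n).map π) (π n) := by
    intro n
    rw [← hH]
  have hnf : ∀ n, 𝒢.owner (π n) = .eloise →
      π (n + 1) = f.next ((List.range (n + 1)).map π) := by
    intro n ho
    rw [hnext]
    simp only [nxt, ho]
    rw [List.range_succ, List.map_append]; rfl
  have hng : ∀ n, 𝒢.owner (π n) = .abelard →
      π (n + 1) = g.next ((List.range (n + 1)).map π) := by
    intro n ho
    rw [hnext]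
    simp only [nxt, ho]
    rw [List.range_succ, List.map_append]; rfl
  have hsplit : ∀ (n : ℕ) (h : List B) (x y : B) (s : List B),
      (List.range n).map π = h ++ x :: y :: s →
      ∃ k, x = π k ∧ y = π (k + 1) ∧ h ++ [x] = (List.range (k + 1)).map π := by
    intro n h x y s hs
    have hlen : n = h.length + (s.length + 2) := by
      have := congrArg List.length hs
      simpa using this
    have hk : h ++ [x] = (List.range (h.length + 1)).map π := by
      have := congrArg (List.take (h.length + 1)) hs
      rw [← List.map_take, List.take_range, min_eq_left (by omega)] at this
      rw [this, List.take_append]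
      simp
    refine ⟨h.length, ?_, ?_, hk⟩
    · have := congrArg (fun l => l[h.length]?) hs
      simpa [List.getElem?_range (show h.length < n by omega)] using this.symm
    · have := congrArg (fun l => l[h.length + 1]?) hs
      simpa [List.getElem?_range (show h.length + 1 < n by omega)] using this.symm
  have hstuck : ∀ n, (∀ k < n, 𝒢.edge (π k) (π (k + 1))) → ∃ c, 𝒢.edge (π n) c := by
    intro n hn
    by_contra! hc
    have e : (List.range (n + 1)).map π = (List.range n).map π ++ [π n] := by
      rw [List.range_succ, List.map_append]; rfl
    have hhead : ((List.range n).map π ++ [π n]).head? = some b := by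
      rw [← e, List.range_succ_eq_map]; rfl
    have hchain : ((List.range n).map π ++ [π n]).IsChain 𝒢.edge := by
      rw [← e, List.isChain_iff_getElem]
      intro k hk
      simp only [List.length_map, List.length_range] at hk
      simpa using hn k (by omega)
    have h1 := hf.1 _ _ ⟨hhead, hchain, fun h x y s hs ho => by
      obtain ⟨k, rfl, rfl, hk⟩ := hsplit (n + 1) h x y s (e.trans hs)
      rw [hk]; exact hnf k ho⟩ hc
    have h2 := hg.1 _ _ ⟨hhead, hchain, fun h x y s hs ho => by
      obtain ⟨k, rfl, rfl, hk⟩ := hsplit (n + 1) h x y s (e.trans hs)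
      rw [hk]; exact hng k ho⟩ hc
    cases ho : 𝒢.owner (π n) with
    | eloise => exact h1 ho
    | abelard => exact h2 ho
  have hedge : ∀ n, 𝒢.edge (π n) (π (n + 1)) := by
    intro n
    induction n using Nat.strong_induction_on with
    | _ n ih =>
      have hc := hstuck n ih
      cases ho : 𝒢.owner (π n) with
      | eloise =>
        rw [hnext]; simp only [nxt, ho]
        exact f.legal _ _ ho hc
      | abelard =>
        rw [hnext]; simp only [nxt, ho]
        exact g.legal _ _ ho hc
  exact hg.2 π ⟨rfl, hedge, hng⟩ (hf.2 π ⟨rfl, hedge, hnf⟩)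

end ParityGame


/-! ### Syntax graphs with an open end -/

variable {P : Type u} {A : Type v}

/-- A syntax graph with an open end: edges may lead to an additional vertex, the *exit*, which is
represented by `none`. The exit itself may be the initial vertex. That every simple cycle meets the
domain of `Ω` is expressed by a rank that decreases along all other edges. -/
structure OpenGraph (P : Type u) (A : Type v) where
  /-- The vertices other than the exit. -/
  V : Type
  finite : Finite V
  /-- The edges. -/
  E : V → Option V → Prop
  /-- The labels. -/
  L : V → Label P A
  /-- The partial priority function. -/
  Ω : V → Option ℕ
  /-- The initial vertex. -/
  init : Option V
  arity_cond : ∀ x, {y | E x y}.ncard = (L x).arity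
  acyclic : ∃ rank : V → ℕ, ∀ x y, E x (some y) → Ω x = none → Ω y = none → rank y < rank x

/-- The Boolean label of the vertices at which the given player chooses. -/
def boolLabel : Player → Label P A
  | .eloise => .or
  | .abelard => .and

theorem arity_boolLabel (j : Player) : (boolLabel j : Label P A).arity = 2 := by
  cases j <;> rfl

namespace OpenGraph

/-- The extension of a map of vertices by a value for the exit. -/
def lift {V W : Type} (f : V → W) (a : Option W) (z : Option V) : Option W :=
  z.elim a fun x => some (f x)

@[simp] theorem lift_none {V W : Type} (f : V → W) (a : Option W) : lift f a none = a := rfl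

@[simp] theorem lift_some {V W : Type} (f : V → W) (a : Option W) (x : V) :
    lift f a (some x) = some (f x) := rfl

theorem lift_injective {V W : Type} {f : V → W} {a : Option W} (hf : f.Injective)
    (ha : ∀ x, a ≠ some (f x)) : (lift f a).Injective := by
  rintro (_ | x) (_ | y) h
  · rfl
  · exact absurd h (ha y)
  · exact absurd h.symm (ha x)
  · exact congrArg some (hf (Option.some.inj h))

variable (G H : OpenGraph P A)

theorem exists_bounded_rank : ∃ (rank : G.V → ℕ) (b : ℕ), (∀ x, rank x < b) ∧
    ∀ x y, G.E x (some y) → G.Ω x = none → G.Ω y = none → rank y < rank x := by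
  obtain ⟨rank, h⟩ := G.acyclic
  have := G.finite
  obtain ⟨b, hb⟩ := (Set.finite_range rank).bddAbove
  exact ⟨rank, b + 1, fun x => Nat.lt_succ_of_le (hb ⟨x, rfl⟩), h⟩

theorem exists_prio_lt : ∃ b, ∀ x n, G.Ω x = some n → n < b := by
  have := G.finite
  obtain ⟨b, hb⟩ := (Set.finite_range fun x => (G.Ω x).getD 0).bddAbove
  refine ⟨b + 1, fun x n hx => Nat.lt_succ_of_le (hb ⟨x, ?_⟩)⟩
  simp [hx]

theorem ncard_lift {W : Type} {f : G.V → W} {a : Option W} (hf : f.Injective)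
    (ha : ∀ x, a ≠ some (f x)) (x : G.V) :
    {y | ∃ z, G.E x z ∧ y = lift f a z}.ncard = (G.L x).arity := by
  rw [← G.arity_cond x, ← Set.ncard_image_of_injective _ (lift_injective hf ha)]
  congr 1
  ext y
  simp [eq_comm]

/-- `f` embeds `G` into `H` such that the exit of `G` is identified with the vertex `a` of `H`. -/
structure IsEmbedding {G H : OpenGraph P A} (f : G.V → H.V) (a : Option H.V) : Prop where
  injective : f.Injective
  edge : ∀ x y, H.E (f x) y ↔ ∃ z, G.E x z ∧ y = lift f a z
  label : ∀ x, H.L (f x) = G.L x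
  prio : ∀ x, H.Ω (f x) = G.Ω x

/-- The condition on the head `h` of priority `n`, with its leaving successor `l` and its remaining
successor `r`. That a vertex cannot be reached is witnessed by a closed set: from `r`, one remains
in the set `R` up to a return to `h`; from `l`, one remains in the set `Q` until one meets a
priority larger than `n`. As `R` consists of vertices other than the exit, the exit cannot be
reached from `r` without returning to `h`. -/
def HeadCond (h : G.V) (n : ℕ) : Prop :=
  ∃ l r : Option G.V, {y | G.E h y} = {l, r} ∧
    (∃ R : Set G.V, (∃ x ∈ R, r = some x) ∧
      (∀ x ∈ R, ∀ y, G.E x y → y = some h ∨ ∃ x' ∈ R, y = some x') ∧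
      ∀ x ∈ R, ∀ m, G.Ω x = some m → m < n) ∧
    ∃ Q : Set G.V, h ∉ Q ∧ ∀ y, (some y = l ∨ ∃ x ∈ Q, G.E x (some y)) →
      y ∈ Q ∨ ∃ m, G.Ω y = some m ∧ n < m

/-- The defining conditions of game logic graphs (with exit), for graphs with an open end. -/
structure IsGL : Prop where
  injective : ∀ x y n, G.Ω x = some n → G.Ω y = some n → x = y
  parity : ∀ x n, G.Ω x = some n →
    (Odd n → G.L x = boolLabel .eloise) ∧ (Even n → G.L x = boolLabel .abelard)
  headCond : ∀ x n, G.Ω x = some n → G.HeadCond x n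

variable {G H}

/-- Head conditions are preserved by an embedding if, after the exit, the image of the embedding
is not reached again without meeting a larger priority. -/
theorem HeadCond.map {f : G.V → H.V} {a : Option H.V} (hf : IsEmbedding f a) (C : Set H.V)
    (hC : ∀ x ∈ C, ∀ y, H.E x (some y) → y ∈ C) (hCf : ∀ x, f x ∉ C) {h : G.V} {n : ℕ}
    (ha : ∀ y, a = some y → y ∈ C ∨ ∃ m, H.Ω y = some m ∧ n < m)
    (hh : G.HeadCond h n) : H.HeadCond (f h) n := by
  obtain ⟨l, r, hE, ⟨R, ⟨x₀, hx₀, hr⟩, hR, hRn⟩, Q, hhQ, hQ⟩ := hh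
  have hlift : ∀ (z : Option G.V) (y : H.V), some y = lift f a z →
      (∀ x, z = some x → x ∈ Q ∨ ∃ m, G.Ω x = some m ∧ n < m) →
      y ∈ f '' Q ∪ C ∨ ∃ m, H.Ω y = some m ∧ n < m := by
    rintro (_ | x) y hy hz
    · rcases ha y hy.symm with h | h
      · exact Or.inl (Or.inr h)
      · exact Or.inr h
    · obtain rfl : y = f x := Option.some.inj hy
      rcases hz x rfl with h | h
      · exact Or.inl (Or.inl ⟨x, h, rfl⟩)
      · exact Or.inr (by rwa [hf.prio])
  refine ⟨lift f a l, lift f a r, ?_, ⟨f '' R, ⟨f x₀, ⟨x₀, hx₀, rfl⟩, by rw [hr]; rfl⟩, ?_, ?_⟩,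
    f '' Q ∪ C, ?_, ?_⟩
  · ext y
    have hE' : ∀ z, G.E h z ↔ z = l ∨ z = r := fun z => by
      simpa using Set.ext_iff.mp hE z
    simp only [Set.mem_ofPred_eq, hf.edge, hE', Set.mem_insert_iff, Set.mem_singleton_iff]
    constructor
    · rintro ⟨z, rfl | rfl, rfl⟩ <;> simp
    · rintro (rfl | rfl)
      · exact ⟨l, Or.inl rfl, rfl⟩
      · exact ⟨r, Or.inr rfl, rfl⟩
  · rintro _ ⟨x, hx, rfl⟩ y hy
    obtain ⟨z, hz, rfl⟩ := (hf.edge _ _).mp hy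
    rcases hR x hx z hz with rfl | ⟨x', hx', rfl⟩
    · exact Or.inl rfl
    · exact Or.inr ⟨f x', ⟨x', hx', rfl⟩, rfl⟩
  · rintro _ ⟨x, hx, rfl⟩ m hm
    rw [hf.prio] at hm
    exact hRn x hx m hm
  · rintro (⟨x, hx, he⟩ | h')
    · exact hhQ (hf.injective he ▸ hx)
    · exact hCf h h'
  · rintro y (hy | ⟨_, ⟨x, hx, rfl⟩ | hx, hy⟩)
    · exact hlift l y hy fun x hx => hQ x (Or.inl hx.symm)
    · obtain ⟨z, hz, hy'⟩ := (hf.edge _ _).mp hy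
      exact hlift z y hy' fun x' hx' => hQ x' (Or.inr ⟨x, hx, hx' ▸ hz⟩)
    · exact Or.inl (Or.inr (hC _ hx y hy))

/-! ### Constructions on open graphs -/

/-- The graph that consists of the exit only. -/
def skip : OpenGraph P A where
  V := Empty
  finite := inferInstance
  E x := x.elim
  L x := x.elim
  Ω x := x.elim
  init := none
  arity_cond x := x.elim
  acyclic := ⟨fun x => x.elim, fun x => x.elim⟩

/-- A single vertex whose successors are all the exit; this is allowed for literals and for
modalities. -/
def single (lab : Label P A) (hlab : lab.arity ≤ 1) : OpenGraph P A where
  V := Unit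
  finite := inferInstance
  E _ y := lab.arity = 1 ∧ y = none
  L _ := lab
  Ω _ := none
  init := some ()
  arity_cond _ := by
    rcases Nat.le_one_iff_eq_zero_or_eq_one.mp hlab with h | h <;> simp [h]
  acyclic := ⟨fun _ => 0, fun x y h => by simp at h⟩

/-- A new initial vertex at which player `j` chooses between `G` and `H`. -/
def choice (j : Player) (G H : OpenGraph P A) (hG : G.init ≠ none) : OpenGraph P A where
  V := Option (G.V ⊕ H.V)
  finite := by have := G.finite; have := H.finite; infer_instance
  E
    | none, y => y = lift (fun x => some (.inl x)) none G.init ∨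
        y = lift (fun x => some (.inr x)) none H.init
    | some (.inl x), y => ∃ z, G.E x z ∧ y = lift (fun x => some (.inl x)) none z
    | some (.inr x), y => ∃ z, H.E x z ∧ y = lift (fun x => some (.inr x)) none z
  L
    | none => boolLabel j
    | some (.inl x) => G.L x
    | some (.inr x) => H.L x
  Ω
    | none => none
    | some (.inl x) => G.Ω x
    | some (.inr x) => H.Ω x
  init := some none
  arity_cond
    | none => by
      rw [arity_boolLabel]
      refine Set.ncard_pair ?_
      obtain ⟨x, hx⟩ := Option.ne_none_iff_exists'.mp hG
      rw [hx]
      cases H.init <;> simp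
    | some (.inl x) => G.ncard_lift (fun x y h => by simpa using h) (by simp) x
    | some (.inr x) => H.ncard_lift (fun x y h => by simpa using h) (by simp) x
  acyclic := by
    obtain ⟨r, b, hb, hr⟩ := G.exists_bounded_rank
    obtain ⟨s, c, hc, hs⟩ := H.exists_bounded_rank
    refine ⟨fun x => x.elim (b + c) (Sum.elim r s), ?_⟩
    rintro (_ | x | x) (_ | y | y) h hx hy
    · rcases h with h | h <;> revert h <;> cases G.init <;> cases H.init <;> simp
    · exact Nat.lt_add_right _ (hb y)
    · exact Nat.lt_add_left _ (hc y)
    · obtain ⟨_ | z, hz, h⟩ := h <;> simp at h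
    · obtain ⟨_ | z, hz, h⟩ := h <;> simp at h
      exact hr _ _ (h ▸ hz) hx hy
    · obtain ⟨_ | z, hz, h⟩ := h <;> simp at h
    · obtain ⟨_ | z, hz, h⟩ := h <;> simp at h
    · obtain ⟨_ | z, hz, h⟩ := h <;> simp at h
    · obtain ⟨_ | z, hz, h⟩ := h <;> simp at h
      exact hs _ _ (h ▸ hz) hx hy

/-- The exit of `G` is identified with the initial vertex of `H`. -/
def comp (G H : OpenGraph P A) : OpenGraph P A where
  V := G.V ⊕ H.V
  finite := by have := G.finite; have := H.finite; infer_instance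
  E
    | .inl x, y => ∃ z, G.E x z ∧ y = lift .inl (lift .inr none H.init) z
    | .inr x, y => ∃ z, H.E x z ∧ y = lift .inr none z
  L := Sum.elim G.L H.L
  Ω := Sum.elim G.Ω H.Ω
  init := lift .inl (lift .inr none H.init) G.init
  arity_cond
    | .inl x => G.ncard_lift Sum.inl_injective (by cases H.init <;> simp) x
    | .inr x => H.ncard_lift Sum.inr_injective (by simp) x
  acyclic := by
    obtain ⟨r, hr⟩ := G.acyclic
    obtain ⟨s, c, hc, hs⟩ := H.exists_bounded_rank
    refine ⟨Sum.elim (fun x => c + r x) s, ?_⟩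
    rintro (x | x) (y | y) h hx hy
    · obtain ⟨_ | z, hz, h⟩ := h
      · revert h; cases H.init <;> simp
      · simp at h
        exact Nat.add_lt_add_left (hr _ _ (h ▸ hz) hx hy) _
    · exact Nat.lt_add_right _ (hc y)
    · obtain ⟨_ | z, hz, h⟩ := h <;> simp at h
    · obtain ⟨_ | z, hz, h⟩ := h <;> simp at h
      exact hs _ _ (h ▸ hz) hx hy

/-- A new initial vertex of priority `N`, with which the exit of `G` is identified, and at which
player `j` chooses between the new exit and `G`. -/
def iter (j : Player) (N : ℕ) (G : OpenGraph P A) : OpenGraph P A where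
  V := Option G.V
  finite := by have := G.finite; infer_instance
  E
    | none, y => y = none ∨ y = lift some (some none) G.init
    | some x, y => ∃ z, G.E x z ∧ y = lift some (some none) z
  L x := x.elim (boolLabel j) G.L
  Ω x := x.elim (some N) G.Ω
  init := some none
  arity_cond
    | none => by
      refine (Set.ncard_pair ?_).trans (arity_boolLabel j).symm
      cases G.init <;> simp
    | some x => G.ncard_lift (Option.some_injective _) (by simp) x
  acyclic := by
    obtain ⟨r, hr⟩ := G.acyclic
    refine ⟨fun x => x.elim 0 r, ?_⟩
    rintro (_ | x) (_ | y) h hx hy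
    · simp at hx
    · simp at hx
    · simp at hy
    · obtain ⟨_ | z, hz, h⟩ := h <;> simp at h
      exact hr _ _ (h ▸ hz) hx hy

variable {j : Player} {N : ℕ} {hG : G.init ≠ none}

theorem isEmbedding_choice_left :
    IsEmbedding (G := G) (H := choice j G H hG) (fun x => some (.inl x)) none :=
  ⟨fun _ _ h => Sum.inl_injective (Option.some.inj h), fun _ _ => Iff.rfl, fun _ => rfl,
    fun _ => rfl⟩

theorem isEmbedding_choice_right :
    IsEmbedding (G := H) (H := choice j G H hG) (fun x => some (.inr x)) none :=
  ⟨fun _ _ h => Sum.inr_injective (Option.some.inj h), fun _ _ => Iff.rfl, fun _ => rfl,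
    fun _ => rfl⟩

theorem isEmbedding_comp_left :
    IsEmbedding (G := G) (H := comp G H) Sum.inl (lift .inr none H.init) :=
  ⟨Sum.inl_injective, fun _ _ => Iff.rfl, fun _ => rfl, fun _ => rfl⟩

theorem isEmbedding_comp_right : IsEmbedding (G := H) (H := comp G H) Sum.inr none :=
  ⟨Sum.inr_injective, fun _ _ => Iff.rfl, fun _ => rfl, fun _ => rfl⟩

theorem isEmbedding_iter :
    IsEmbedding (G := G) (H := iter j N G) some (some none) :=
  ⟨Option.some_injective _, fun _ _ => Iff.rfl, fun _ => rfl, fun _ => rfl⟩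

theorem isGL_skip : (skip : OpenGraph P A).IsGL :=
  ⟨fun x => x.elim, fun x => x.elim, fun x => x.elim⟩

theorem isGL_single (lab : Label P A) (hlab : lab.arity ≤ 1) : (single lab hlab).IsGL :=
  ⟨fun _ _ _ h => (Option.some_ne_none _ h.symm).elim,
    fun _ _ h => (Option.some_ne_none _ h.symm).elim,
    fun _ _ h => (Option.some_ne_none _ h.symm).elim⟩

theorem IsGL.choice (h₁ : G.IsGL) (h₂ : H.IsGL)
    (hlt : ∀ x y m n, G.Ω x = some m → H.Ω y = some n → m < n) : (choice j G H hG).IsGL where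
  injective := by
    rintro (_ | x | x) (_ | y | y) n hx hy
    · rfl
    · cases hx
    · cases hx
    · cases hy
    · rw [h₁.injective x y n hx hy]
    · exact absurd (hlt x y n n hx hy) (lt_irrefl n)
    · cases hy
    · exact absurd (hlt y x n n hy hx) (lt_irrefl n)
    · rw [h₂.injective x y n hx hy]
  parity := by
    rintro (_ | x | x) n hx
    · cases hx
    · exact h₁.parity x n hx
    · exact h₂.parity x n hx
  headCond := by
    rintro (_ | x | x) n hx
    · cases hx
    · exact (h₁.headCond x n hx).map isEmbedding_choice_left ∅ (fun _ h => h.elim) (fun _ h => h)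
        fun _ h => nomatch h
    · exact (h₂.headCond x n hx).map isEmbedding_choice_right ∅ (fun _ h => h.elim) (fun _ h => h)
        fun _ h => nomatch h

theorem IsGL.comp (h₁ : G.IsGL) (h₂ : H.IsGL)
    (hlt : ∀ x y m n, G.Ω x = some m → H.Ω y = some n → m < n) : (comp G H).IsGL where
  injective := by
    rintro (x | x) (y | y) n hx hy
    · rw [h₁.injective x y n hx hy]
    · exact absurd (hlt x y n n hx hy) (lt_irrefl n)
    · exact absurd (hlt y x n n hy hx) (lt_irrefl n)
    · rw [h₂.injective x y n hx hy]
  parity := by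
    rintro (x | x) n hx
    · exact h₁.parity x n hx
    · exact h₂.parity x n hx
  headCond := by
    rintro (x | x) n hx
    · refine (h₁.headCond x n hx).map isEmbedding_comp_left (Set.range Sum.inr) ?_
        (by rintro y ⟨z, hz⟩; cases hz) ?_
      · rintro _ ⟨x, rfl⟩ y ⟨_ | z, -, h⟩
        · cases h
        · exact ⟨z, (Option.some.inj h).symm⟩
      · intro y hy
        left
        revert hy
        cases H.init with
        | none => intro hy; cases hy
        | some z => intro hy; exact ⟨z, Option.some.inj hy⟩
    · exact (h₂.headCond x n hx).map isEmbedding_comp_right ∅ (fun _ h => h.elim) (fun _ h => h)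
        fun _ h => nomatch h

/-- The new head leaves to the exit; the priority `N` being the largest one, the cycles of `G`
that are closed through the new head do not affect the conditions on the heads of `G`. -/
theorem IsGL.iter (h : G.IsGL) (hG : G.init ≠ none) (hN : ∀ x n, G.Ω x = some n → n < N)
    (hj : (Odd N → j = .eloise) ∧ (Even N → j = .abelard)) : (iter j N G).IsGL where
  injective := by
    rintro (_ | x) (_ | y) n hx hy
    · rfl
    · obtain rfl := Option.some.inj hx
      exact absurd (hN y _ hy) (lt_irrefl _)
    · obtain rfl := Option.some.inj hy
      exact absurd (hN x _ hx) (lt_irrefl _)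
    · rw [h.injective x y n hx hy]
  parity := by
    rintro (_ | x) n hx
    · obtain rfl := Option.some.inj hx
      exact ⟨fun ho => congrArg boolLabel (hj.1 ho), fun he => congrArg boolLabel (hj.2 he)⟩
    · exact h.parity x n hx
  headCond := by
    rintro (_ | x) n hx
    · obtain rfl := Option.some.inj hx
      obtain ⟨x₀, hx₀⟩ := Option.ne_none_iff_exists'.mp hG
      refine ⟨none, lift some (some none) G.init, rfl, ⟨Set.range some, ⟨some x₀, ⟨x₀, rfl⟩, by
        rw [hx₀]; rfl⟩, ?_, ?_⟩, ∅, fun h => h, ?_⟩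
      · rintro _ ⟨x, rfl⟩ y ⟨_ | z, -, rfl⟩
        · exact Or.inl rfl
        · exact Or.inr ⟨some z, ⟨z, rfl⟩, rfl⟩
      · rintro _ ⟨x, rfl⟩ m hm
        exact hN x m hm
      · rintro y (hy | ⟨x, hx, -⟩)
        · cases hy
        · exact hx.elim
    · refine (h.headCond x n hx).map isEmbedding_iter ∅ (fun _ h => h.elim) (fun _ h => h) ?_
      rintro y hy
      obtain rfl := Option.some.inj hy
      exact Or.inr ⟨N, rfl, hN x n hx⟩

/-! ### Closing an open graph -/

/-- The exit becomes a vertex with the label `e`. -/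
def close (e : P) (G : OpenGraph P A) : PointedSyntaxGraph P A where
  V := Option G.V
  finite := by have := G.finite; infer_instance
  E x y := ∃ z ∈ x, G.E z y
  L x := x.elim (.pos e) G.L
  Ω x := x.bind G.Ω
  arity_cond
    | none => by simp [Label.arity]
    | some x => by simpa using G.arity_cond x
  priority_cond := by
    obtain ⟨rank, hrank⟩ := G.acyclic
    rintro p ⟨⟨hne, hchain, -⟩, x, hx, y, hy, z, hz, hxy⟩
    by_contra! hp
    let rk : Option G.V → ℕ := fun x => x.elim 0 fun x => rank x + 1
    have hdec : ∀ x ∈ p, ∀ y ∈ p, (∃ z ∈ x, G.E z y) → rk y < rk x := by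
      rintro _ hx (_ | y) hy ⟨z, rfl, hE⟩
      · exact Nat.succ_pos _
      · have h1 := hp _ hx
        have h2 := hp _ hy
        simp only [Option.bind_some, Bool.not_eq_true, Option.isSome_eq_false_iff,
          Option.isNone_iff_eq_none] at h1 h2
        exact Nat.succ_lt_succ (hrank z y hE h1 h2)
    have hx' : x ∈ p := List.mem_of_getLast? hx
    have hy' : y ∈ p := List.mem_of_head? hy
    have hlt := hdec x hx' y hy' ⟨z, hz, hxy⟩
    -- The rank decreases along the path, so it cannot increase from its last to its first vertex.
    have hle : rk x ≤ rk y := by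
      have hc : p.IsChain (fun a b => rk b < rk a) := by
        rw [List.isChain_iff_getElem] at hchain ⊢
        exact fun k hk => hdec _ (List.getElem_mem _) _ (List.getElem_mem _) (hchain k hk)
      have := hc.pairwise
      cases p with
      | nil => exact absurd rfl hne
      | cons a t =>
        obtain rfl : a = y := by simpa using hy
        rcases List.mem_cons.mp hx' with rfl | h
        · exact le_rfl
        · exact (List.rel_of_pairwise_cons this h).le
    omega
  vI := G.init

theorem exists_head (e : P) (n : (G.close e).PrioRange) :
    ∃ x, SyntaxGraph.head n = some x ∧ G.Ω x = some n.val := by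
  have h := SyntaxGraph.prio_head n
  generalize SyntaxGraph.head n = y at h ⊢
  cases y with
  | none => cases h
  | some x => exact ⟨x, rfl, h⟩

/-- A path that starts in a set which is closed under edges remains there. -/
theorem forall_mem_of_isChain {V : Type} {E : V → V → Prop} {D : V → Prop} {p : List V}
    (hp : p.IsChain E) (h0 : ∀ x ∈ p.head?, D x) (hD : ∀ x ∈ p, ∀ y ∈ p, E x y → D x → D y) :
    ∀ x ∈ p, D x := by
  have hc : p.IsChain (fun a b => D a → D b) := by
    rw [List.isChain_iff_getElem] at hp ⊢
    exact fun k hk => hD _ (List.getElem_mem _) _ (List.getElem_mem _) (hp k hk)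
  have : IsTrans V (fun a b => D a → D b) := ⟨fun _ _ _ h₁ h₂ h => h₂ (h₁ h)⟩
  cases p with
  | nil => simp
  | cons a t =>
    intro x hx
    rcases List.mem_cons.mp hx with rfl | h
    · exact h0 x rfl
    · exact List.rel_of_pairwise_cons hc.pairwise h (h0 a rfl)

/-- The conditions with and without exit hold for the same choice of leaving and remaining
successors. -/
theorem isGameLogicGraph_close_aux (h : G.IsGL) (e : P) :
    (G.close e).InjectivePrio ∧ (G.close e).Parity ∧
      ∃ l r : (G.close e).PrioRange → (G.close e).V, (G.close e).Brexit l r ∧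
        ((∀ x, G.L x ≠ .pos e) → (G.close e).ExitCond e r) := by
  refine ⟨?_, ?_, ?_⟩
  · rintro (_ | x) (_ | y) n hx hy
    · rfl
    · cases hx
    · cases hy
    · rw [h.injective x y n hx hy]
  · intro n
    obtain ⟨x, hx, hn⟩ := exists_head e n
    rw [hx]
    exact h.parity x _ hn
  · choose hd hhd hΩ using exists_head (G := G) e
    choose l r hE hR hQ using fun n => h.headCond (hd n) _ (hΩ n)
    choose R hr hR hRlt using hR
    choose Q hhQ hQ using hQ
    -- Without returning to the head, paths from the remaining successor stay in `R`.
    have hremain : ∀ n, ∀ q, IsSimplePath (G.close e).E (SyntaxGraph.head n :: r n :: q) →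
        ∀ y, (SyntaxGraph.head n :: r n :: q).getLast? = some y → ∃ x ∈ R n, y = some x := by
      rintro n q ⟨-, hc, hnd⟩ y hy
      have hc' := List.IsChain.tail hc
      refine forall_mem_of_isChain (D := fun y => ∃ x ∈ R n, y = some x) hc' ?_ ?_ y ?_
      · intro y hy
        obtain rfl : r n = y := Option.some.inj hy
        exact hr n
      · rintro _ hx y hy ⟨z, rfl, hzy⟩ ⟨x, hxR, hxz⟩
        obtain rfl := Option.some.inj hxz
        rcases hR n _ hxR y hzy with rfl | h
        · rw [hhd] at hnd
          exact absurd hy (List.nodup_cons.mp hnd).1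
        · exact h
      · exact List.mem_of_getLast? (List.getLast?_cons_cons.symm.trans hy)
    refine ⟨l, r, fun n => ⟨?_, ?_, ?_⟩, ?_⟩
    · rw [hhd]
      refine Eq.trans ?_ (hE n)
      ext y
      exact ⟨fun ⟨z, hz, h⟩ => Option.some.inj hz ▸ h, fun h => ⟨_, rfl, h⟩⟩
    · rintro p ⟨-, hc, -⟩ h0 hlast
      by_contra hle
      have hle' : ∀ x ∈ p, ∀ m, (G.close e).Ω x = some m → m ≤ n.val := by
        intro x hx m hm
        by_contra! hlt
        exact hle (lt_of_lt_of_le (WithBot.coe_lt_coe.mpr hlt)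
          (List.le_maximum_of_mem' (List.mem_filterMap.mpr ⟨x, hx, hm⟩)))
      have key := forall_mem_of_isChain (D := fun y => ∀ x, y = some x → x ∈ Q n) hc ?_ ?_ _
        (List.mem_of_getLast? hlast) (hd n) (hhd n)
      · exact hhQ n key
      · rintro y hy x rfl
        have h1 : some x = l n := Option.some.inj (Eq.trans (Eq.symm hy) h0)
        rcases hQ n x (Or.inl h1) with h | ⟨m, hm, hlt⟩
        · exact h
        · exact absurd (hle' _ (List.mem_of_head? hy) m hm) (not_le.mpr hlt)
      · rintro _ hx _ hy ⟨z, rfl, hzy⟩ hz x rfl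
        rcases hQ n x (Or.inr ⟨z, hz z rfl, hzy⟩) with h | ⟨m, hm, hlt⟩
        · exact h
        · exact absurd (hle' _ hy m hm) (not_le.mpr hlt)
    · rintro m hlt ⟨q, hq, hlast⟩
      obtain ⟨x, hx, hmx⟩ := hremain n q hq _ hlast
      have h1 : x = hd m := Option.some.inj (hmx.symm.trans (hhd m))
      exact absurd (hRlt n x hx _ (h1 ▸ hΩ m)) (not_lt.mpr hlt.le)
    · rintro hL n y hy ⟨q, hq, hlast⟩
      obtain ⟨x, -, rfl⟩ := hremain n q hq _ hlast
      exact hL x hy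

theorem IsGL.isGameLogicGraph_close (h : G.IsGL) (e : P) : (G.close e).IsGameLogicGraph := by
  obtain ⟨h1, h2, l, r, h3, -⟩ := isGameLogicGraph_close_aux h e
  exact ⟨h1, h2, l, r, h3⟩

theorem IsGL.isGameLogicGraphWithExit_close (h : G.IsGL) (e : P)
    (he : ∀ x, G.L x ≠ .pos e ∧ G.L x ≠ .neg e) : (G.close e).IsGameLogicGraphWithExit e := by
  obtain ⟨h1, h2, l, r, h3, h4⟩ := isGameLogicGraph_close_aux h e
  refine ⟨?_, h1, h2, l, r, h3, h4 fun x => (he x).1⟩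
  rintro (_ | x) hx
  · cases hx
  · exact (he x).2 hx

end OpenGraph


/-! ### Neighbourhood frames from the point of view of a player -/

namespace MF

variable {S : Type w}

/-- The frame that describes what player `i` can force, if `f` describes what Eloise can force. -/
def side : Player → MF S → MF S
  | .eloise, f => f
  | .abelard, f => dual f

/-- The frame in which every set is a neighbourhood of the points of `Z`, and no set is one of the
other points. It represents a formula as a game. -/
def const (Z : Set S) : MF S := fun s => ⟨fun _ => s ∈ Z, fun _ _ _ h => h⟩

/-- The choice of player `j` between two frames. -/
noncomputable def choice : Player → MF S → MF S → MF S
  | .eloise, f, g => f ⊔ g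
  | .abelard, f, g => f ⊓ g

/-- The iteration controlled by player `j`. -/
noncomputable def iter : Player → MF S → MF S
  | .eloise, f => angelIter f
  | .abelard, f => demonIter f

theorem side_comp (i : Player) (f g : MF S) : side i (comp f g) = comp (side i f) (side i g) := by
  cases i with
  | eloise => rfl
  | abelard =>
    ext s U
    change (¬ f s {s' | g s' Uᶜ}) ↔ ¬ f s {s' | ¬ g s' Uᶜ}ᶜ
    rw [show {s' | ¬ g s' Uᶜ}ᶜ = {s' | g s' Uᶜ} by ext; simp]

theorem side_unit {i : Player} {s : S} {X : Set S} (h : side i unit s X) : s ∈ X := by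
  cases i with
  | eloise => exact h
  | abelard => exact not_not.mp h

theorem side_choice_self {j : Player} {f g : MF S} {s : S} {X : Set S}
    (h : side j (choice j f g) s X) : side j f s X ∨ side j g s X := by
  cases j with
  | eloise => exact h
  | abelard => exact not_and_or.mp h

theorem side_choice_of_ne {i j : Player} (hij : i ≠ j) {f g : MF S} {s : S} {X : Set S}
    (h : side i (choice j f g) s X) : side i f s X ∧ side i g s X := by
  cases i <;> cases j
  · exact absurd rfl hij
  · exact h
  · exact not_or.mp h
  · exact absurd rfl hij

theorem side_side_self {j : Player} {f : MF S} {s : S} {X : Set S} (h : side j (side j f) s X) :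
    f s X := by
  cases j with
  | eloise => exact h
  | abelard =>
    have := not_not.mp h
    rwa [compl_compl] at this

theorem side_side_of_ne {i j : Player} (hij : i ≠ j) {f : MF S} {s : S} {X : Set S}
    (h : side i (side j f) s X) : ¬ f s Xᶜ := by
  cases i <;> cases j
  · exact absurd rfl hij
  · exact h
  · exact h
  · exact absurd rfl hij

/-- For the player who controls it, iteration is contained in every prefixed point. -/
theorem mem_of_side_iter_self {j : Player} {f : MF S} {s : S} {X Z : Set S}
    (h : side j (iter j f) s X) (hX : X ⊆ Z) (hZ : ∀ t, side j f t Z → t ∈ Z) : s ∈ Z := by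
  cases j with
  | eloise =>
    -- The intersections of prefixed points above the given set form a prefixed point of frames.
    let g : MF S := fun s => ⟨fun U => ∀ Z, U ⊆ Z → (∀ t, f t Z → t ∈ Z) → s ∈ Z,
      fun _ _ hUV hU Z hV => hU Z (hUV.trans hV)⟩
    have hg : angelMap f g ≤ g := by
      rintro t U (ht | ht) Z hU hZ
      · exact hU ht
      · exact hZ t ((f t).mono (fun t' (ht' : g t' U) => ht' Z hU hZ) ht)
    exact OrderHom.lfp_le _ hg s X h Z hX hZ
  | abelard =>
    -- Dually, the unions of postfixed points below the given set form a postfixed point of frames.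
    let g : MF S := fun s => ⟨fun U => ∃ Y, s ∈ Y ∧ Y ⊆ U ∧ ∀ t ∈ Y, f t Y,
      fun _ _ hUV ⟨Y, hs, hU, hY⟩ => ⟨Y, hs, hU.trans hUV, hY⟩⟩
    have hg : g ≤ demonMap f g := by
      rintro t U ⟨Y, ht, hU, hY⟩
      exact ⟨hU ht, (f t).mono (fun t' ht' => ⟨Y, ht', hU, hY⟩) (hY t ht)⟩
    by_contra hs
    refine h (OrderHom.le_gfp _ hg s _ ⟨Zᶜ, hs, Set.compl_subset_compl.mpr hX, fun t ht => ?_⟩)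
    by_contra hft
    exact ht (hZ t hft)

/-- For the player who does not control it, iteration is contained in some postfixed point. -/
theorem exists_of_side_iter {i j : Player} (hij : i ≠ j) {f : MF S} {s : S} {X : Set S}
    (h : side i (iter j f) s X) : ∃ Y, s ∈ Y ∧ Y ⊆ X ∧ ∀ t ∈ Y, side i f t Y := by
  cases i <;> cases j
  · exact absurd rfl hij
  · have hfix : ∀ t, demonIter f t X → t ∈ X ∧ f t {t | demonIter f t X} := by
      intro t ht
      have : demonMap f (demonIter f) = demonIter f := OrderHom.map_gfp _
      rw [← this] at ht
      exact ht
    exact ⟨{t | demonIter f t X}, h, fun t ht => (hfix t ht).1, fun t ht => (hfix t ht).2⟩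
  · have hfix : ∀ t, t ∈ Xᶜ ∨ f t {t | angelIter f t Xᶜ} → angelIter f t Xᶜ := by
      intro t ht
      have : angelMap f (angelIter f) = angelIter f := OrderHom.map_lfp _
      rw [← this]
      exact ht
    refine ⟨{t | ¬ angelIter f t Xᶜ}, h, fun t ht => ?_, fun t ht hft => ?_⟩
    · by_contra htX
      exact ht (hfix t (Or.inl htX))
    · refine ht (hfix t (Or.inr ((f t).mono (fun t' ht' => ?_) hft)))
      exact not_not.mp ht'
  · exact absurd rfl hij

end MF

/-! ### The acceptance game of an open graph -/

namespace OpenGraph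

open ParityGame SyntaxGraph

variable {P : Type u} {A : Type v} {G H : OpenGraph P A} {e : P} {S : Type w}
  {M : GameModel P A S} {i j : Player}

/-- The acceptance game of the closed graph. -/
noncomputable abbrev game (e : P) (G : OpenGraph P A) (M : GameModel P A S) :
    ParityGame ((G.close e).Position S) :=
  (G.close e).acceptanceGame M

/-- The position of the acceptance game at the vertex `z`, which may be the exit, and the
state `s`. -/
def posAt (e : P) (G : OpenGraph P A) (z : Option G.V) (s : S) : (G.close e).Position S :=
  .state z s

/-- The positions of the acceptance game at vertices other than the exit. -/
def inner (e : P) (G : OpenGraph P A) (S : Type w) : Set ((G.close e).Position S) :=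
  {b | ∃ x : G.V, (∃ s, b = posAt e G (some x) s) ∨
    ∃ U, b = Position.nbhd (𝔾 := (G.close e).toSyntaxGraph) (some x) U}

/-- What player `i` can force in the acceptance game from the vertex `z`, if the play ends at the
exit, where `i` aims for a state in `X`. -/
def Wins (e : P) (G : OpenGraph P A) (M : GameModel P A S) (i : Player) (z : Option G.V)
    (s : S) (X : Set S) : Prop :=
  posAt e G z s ∈ (G.game e M).Forces i (inner e G S) (posAt e G none '' X)

/-- At the initial vertex of `G`, both players can force what they can force in the frame `F`. -/
def Realizes (e : P) (G : OpenGraph P A) (F : ∀ S : Type w, GameModel P A S → MF S) : Prop :=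
  ∀ (S : Type w) (M : GameModel P A S) (i : Player) (s : S) (X : Set S),
    MF.side i (F S M) s X → Wins e G M i G.init s X

theorem step_of_boolLabel {x : G.V} {s : S} {Z : Set ((G.close e).Position S)}
    (hL : G.L x = boolLabel j) (h : i = j → ∃ y, G.E x y ∧ posAt e G y s ∈ Z)
    (h' : i ≠ j → ∀ y, G.E x y → posAt e G y s ∈ Z) :
    (G.game e M).Step i (posAt e G (some x) s) Z := by
  have hL' : (G.close e).L (some x) = boolLabel j := hL
  have ho : (G.game e M).owner (posAt e G (some x) s) = j := by
    change (G.close e).owner M (.state (𝔾 := (G.close e).toSyntaxGraph) (some x) s) = j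
    cases j <;> simp only [SyntaxGraph.owner, hL', boolLabel]
  have hL'' : (G.close e).L (some x) = .and ∨ (G.close e).L (some x) = .or := by
    rw [hL']; cases j <;> simp [boolLabel]
  constructor
  · intro hi
    obtain ⟨y, hy, hZ⟩ := h (hi.symm.trans ho)
    exact ⟨_, hZ, hL'', ⟨x, rfl, hy⟩, rfl⟩
  · rintro hi (⟨y, t⟩ | ⟨y, U⟩) hc
    · obtain ⟨-, ⟨z, hz, hy⟩, rfl⟩ := hc
      obtain rfl := Option.some.inj hz
      exact h' (fun h => hi (ho.trans h.symm)) y hy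
    · obtain ⟨-, g, hg | hg, -⟩ := hc
      · rcases hL'' with h | h <;> cases h.symm.trans hg
      · rcases hL'' with h | h <;> cases h.symm.trans hg

/-- The map of positions that is induced by an embedding. -/
def mapPos (e : P) {G H : OpenGraph P A} (f : G.V → H.V) (a : Option H.V) :
    (G.close e).Position S → (H.close e).Position S
  | .state z s => .state (lift f a z) s
  | .nbhd z U => .nbhd (lift f a z) U

/-- The inner positions of `G` behave in the game of `H` as they do in that of `G`, so what can be
forced in `G` up to its exit can be forced in `H` up to the vertex that takes the place of the
exit. -/
theorem forces_map {f : G.V → H.V} {a : Option H.V} (hf : IsEmbedding f a) {z : Option G.V}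
    {s : S} {X : Set S} (h : Wins e G M i z s X) :
    posAt e H (lift f a z) s ∈ (H.game e M).Forces i (inner e H S) (posAt e H a '' X) := by
  have key := forces_image (ℋ := H.game e M) (I' := inner e H S) (mapPos e f a) ?_ ?_ ?_ ?_ h
  · rw [Set.image_image] at key
    exact key
  · rintro _ ⟨x, ⟨s, rfl⟩ | ⟨U, rfl⟩⟩
    · exact ⟨f x, Or.inl ⟨s, rfl⟩⟩
    · exact ⟨f x, Or.inr ⟨U, rfl⟩⟩
  · rintro _ ⟨x, h⟩
    have hL : (H.close e).L (some (f x)) = (G.close e).L (some x) := hf.label x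
    rcases h with ⟨s, rfl⟩ | ⟨U, rfl⟩
    · change (H.close e).owner M (.state (𝔾 := (H.close e).toSyntaxGraph) (some (f x)) s) =
        (G.close e).owner M (.state (𝔾 := (G.close e).toSyntaxGraph) (some x) s)
      simp only [SyntaxGraph.owner, hL]
    · change (H.close e).owner M (.nbhd (𝔾 := (H.close e).toSyntaxGraph) (some (f x)) U) =
        (G.close e).owner M (.nbhd (𝔾 := (G.close e).toSyntaxGraph) (some x) U)
      simp only [SyntaxGraph.owner, hL]
  · rintro _ ⟨x, ⟨s, rfl⟩ | ⟨U, rfl⟩⟩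
    · exact congrArg (fun o : Option ℕ => o.getD 0) (hf.prio x)
    · rfl
  · rintro _ ⟨x, h⟩ c'
    have hL : (H.close e).L (some (f x)) = (G.close e).L (some x) := hf.label x
    have hM : ∀ g, (H.close e).Modal (some (f x)) g ↔ (G.close e).Modal (some x) g := by
      intro g
      change (H.close e).L (some (f x)) = _ ∨ (H.close e).L (some (f x)) = _ ↔ _
      rw [hL]
      rfl
    have hE : ∀ y, (H.close e).E (some (f x)) y ↔
        ∃ z, (G.close e).E (some x) z ∧ y = lift f a z := by
      intro y
      constructor
      · rintro ⟨w, hw, hwy⟩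
        obtain rfl := Option.some.inj hw
        obtain ⟨z, hz, rfl⟩ := (hf.edge x y).mp hwy
        exact ⟨z, ⟨x, rfl, hz⟩, rfl⟩
      · rintro ⟨z, ⟨w, hw, hz⟩, rfl⟩
        obtain rfl := Option.some.inj hw
        exact ⟨f x, rfl, (hf.edge x _).mpr ⟨z, hz, rfl⟩⟩
    rcases h with ⟨s, rfl⟩ | ⟨U, rfl⟩
    · rcases c' with ⟨y, t⟩ | ⟨y, U⟩
      · constructor
        · rintro ⟨h1, h2, rfl⟩
          obtain ⟨z, hz, rfl⟩ := (hE y).mp h2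
          exact ⟨.state z t, ⟨hL ▸ h1, hz, rfl⟩, rfl⟩
        · rintro ⟨⟨z, t'⟩ | ⟨z, U⟩, hc, hc'⟩
          · obtain ⟨h1, h2, rfl⟩ := hc
            cases hc'
            exact ⟨hL.symm ▸ h1, (hE _).mpr ⟨z, h2, rfl⟩, rfl⟩
          · cases hc'
      · constructor
        · rintro ⟨rfl, g, h1, h2⟩
          exact ⟨.nbhd (some x) U, ⟨rfl, g, (hM g).mp h1, h2⟩, rfl⟩
        · rintro ⟨⟨z, t'⟩ | ⟨z, U⟩, hc, hc'⟩
          · cases hc'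
          · obtain ⟨rfl, g, h1, h2⟩ := hc
            cases hc'
            exact ⟨rfl, g, (hM g).mpr h1, h2⟩
    · rcases c' with ⟨y, t⟩ | ⟨y, U'⟩
      · constructor
        · rintro ⟨⟨g, h1⟩, h2, h3⟩
          obtain ⟨z, hz, rfl⟩ := (hE y).mp h2
          exact ⟨.state z t, ⟨⟨g, (hM g).mp h1⟩, hz, h3⟩, rfl⟩
        · rintro ⟨⟨z, t'⟩ | ⟨z, U⟩, hc, hc'⟩
          · obtain ⟨⟨g, h1⟩, h2, h3⟩ := hc
            cases hc'
            exact ⟨⟨g, (hM g).mpr h1⟩, (hE _).mpr ⟨z, h2, rfl⟩, h3⟩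
          · cases hc'
      · constructor
        · rintro ⟨⟩
        · rintro ⟨⟨z, t'⟩ | ⟨z, U⟩, hc, hc'⟩
          · cases hc'
          · exact hc.elim

/-! ### The constructions realize the operations on frames -/

theorem realizes_skip : (skip : OpenGraph P A).Realizes e fun (_ : Type w) _ => MF.unit :=
  fun _ _ _ s _ h => Or.inl ⟨s, MF.side_unit h, rfl⟩

/-- The player who wants the literal to have the truth value it has wins at once, since the
opponent is stuck. -/
theorem realizes_literal (lab : Label P A) (hlab : lab.arity = 0)
    (F : ∀ S : Type w, GameModel P A S → Set S)
    (hF : ∀ S M s, ((single lab (hlab.trans_le zero_le_one)).game e M).owner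
      (posAt e _ (some ()) s) = .abelard ↔ s ∈ F S M) :
    (single lab (hlab.trans_le zero_le_one)).Realizes e fun S M => MF.const (F S M) := by
  intro S M i s X h
  refine forces_of_step ⟨(), Or.inl ⟨s, rfl⟩⟩ ⟨fun ho => ?_, fun _ c hc => ?_⟩
  · exfalso
    have h1 : i = .abelard ↔ s ∈ F S M :=
      Iff.trans ⟨fun h => Eq.trans ho h, fun h => Eq.trans (Eq.symm ho) h⟩ (hF S M s)
    cases i with
    | eloise => exact Player.noConfusion (h1.mpr h)
    | abelard => exact h (h1.mp rfl)
  · exfalso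
    rcases c with ⟨y, t⟩ | ⟨y, U⟩
    · obtain ⟨h1 | h1, -⟩ := hc
      · change lab = _ at h1; rw [h1] at hlab; cases hlab
      · change lab = _ at h1; rw [h1] at hlab; cases hlab
    · obtain ⟨-, g, h1 | h1, -⟩ := hc
      · change lab = _ at h1; rw [h1] at hlab; cases hlab
      · change lab = _ at h1; rw [h1] at hlab; cases hlab

theorem realizes_pos (p : P) : (single (.pos p : Label P A) zero_le_one).Realizes e
    fun (_ : Type w) M => MF.const (M.val p) := by
  refine realizes_literal _ rfl (fun S M => M.val p) fun S M s => ?_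
  classical
  change (if s ∈ M.val p then Player.abelard else Player.eloise) = _ ↔ _
  split_ifs with h <;> simp [h]

theorem realizes_neg (p : P) : (single (.neg p : Label P A) zero_le_one).Realizes e
    fun (_ : Type w) M => MF.const (M.val p)ᶜ := by
  refine realizes_literal _ rfl (fun S M => (M.val p)ᶜ) fun S M s => ?_
  classical
  change (if s ∈ M.val p then Player.eloise else Player.abelard) = _ ↔ _
  split_ifs with h <;> simp [h]

/-- The modal label at which player `j` chooses the neighbourhood. -/
def modalLabel (g : A) : Player → Label P A
  | .eloise => .dia g
  | .abelard => .diaDual g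

theorem arity_modalLabel (g : A) (j : Player) : (modalLabel g j : Label P A).arity = 1 := by
  cases j <;> rfl

theorem modalLabel_inj {g g' : A} {j : Player}
    (h : (modalLabel g j : Label P A) = .dia g' ∨ (modalLabel g j : Label P A) = .diaDual g') :
    g' = g := by
  cases j <;> rcases h with h | h <;> cases h <;> rfl

/-- The player `j` of the label chooses `X` itself as the neighbourhood; the other player finds an
element of `X` in every neighbourhood. -/
theorem realizes_modal (g : A) (j : Player) :
    (single (modalLabel g j : Label P A) (arity_modalLabel g j).le).Realizes e
      fun (_ : Type w) M => MF.side j (M.γ g) := by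
  intro S M i s X h
  have hmodal : (modalLabel g j : Label P A) = .dia g ∨
      (modalLabel g j : Label P A) = .diaDual g := by cases j <;> simp [modalLabel]
  set G : OpenGraph P A := single (modalLabel g j : Label P A) (arity_modalLabel g j).le with hG
  let nb (U : Set S) : (G.close e).Position S :=
    Position.nbhd (𝔾 := (G.close e).toSyntaxGraph) (some ()) U
  have ho : (G.game e M).owner (posAt e G (some ()) s) = j := by cases j <;> rfl
  have ho' : ∀ U, (G.game e M).owner (nb U) = i ↔ i ≠ j := by
    intro U
    cases j
    · change Player.abelard = i ↔ _; cases i <;> simp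
    · change Player.eloise = i ↔ _; cases i <;> simp
  have hmove : ∀ U t, t ∈ U → (G.game e M).edge (nb U) (posAt e G none t) := fun U t ht =>
    ⟨⟨g, hmodal⟩, ⟨(), rfl, arity_modalLabel g j, rfl⟩, ht⟩
  have hX : ∀ t ∈ X, posAt e G none t ∈ (G.game e M).Forces i (inner e G S) (posAt e G none '' X) :=
    fun t ht => Or.inl ⟨t, ht, rfl⟩
  refine forces_of_step ⟨(), Or.inl ⟨s, rfl⟩⟩ ⟨fun hi => ?_, fun hi c hc => ?_⟩
  · obtain rfl : i = j := hi.symm.trans ho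
    refine ⟨nb X, forces_of_step ⟨(), Or.inr ⟨X, rfl⟩⟩ ⟨fun h' => absurd rfl ((ho' X).mp h'), ?_⟩,
      rfl, g, hmodal, MF.side_side_self h⟩
    rintro - (⟨y, t⟩ | ⟨y, U⟩) hc
    · obtain ⟨-, ⟨z, hz, -, rfl⟩, ht⟩ := hc
      exact hX t ht
    · exact hc.elim
  · have hij : i ≠ j := fun h => hi (ho.trans h.symm)
    rcases c with ⟨y, t⟩ | ⟨y, U⟩
    · obtain ⟨h1, -⟩ := hc
      change modalLabel g j = _ ∨ modalLabel g j = _ at h1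
      cases j <;> rcases h1 with h1 | h1 <;> cases h1
    · obtain ⟨rfl, g', h1, h2⟩ := hc
      obtain rfl := modalLabel_inj h1
      -- Every neighbourhood `U` meets `X`.
      have hUX : ∃ t ∈ U, t ∈ X := by
        by_contra! hU
        exact MF.side_side_of_ne hij h ((M.γ g' s).mono hU h2)
      obtain ⟨t, htU, htX⟩ := hUX
      exact forces_of_step (b := nb U) ⟨(), Or.inr ⟨U, rfl⟩⟩
        ⟨fun _ => ⟨_, hX t htX, hmove U t htU⟩, fun h' => absurd ((ho' U).mpr hij) h'⟩

variable {F F' : ∀ S : Type w, GameModel P A S → MF S}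

theorem Realizes.choice {hG : G.init ≠ none} (h₁ : G.Realizes e F) (h₂ : H.Realizes e F') :
    (choice j G H hG).Realizes e fun S M => MF.choice j (F S M) (F' S M) := by
  intro S M i s X h
  have hl : MF.side i (F S M) s X → _ := fun h =>
    forces_map (isEmbedding_choice_left (j := j) (H := H) (hG := hG)) (h₁ S M i s X h)
  have hr : MF.side i (F' S M) s X → _ := fun h =>
    forces_map (isEmbedding_choice_right (j := j) (H := H) (hG := hG)) (h₂ S M i s X h)
  refine forces_of_step ⟨none, Or.inl ⟨s, rfl⟩⟩ (step_of_boolLabel rfl (fun hij => ?_) ?_)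
  · subst hij
    rcases MF.side_choice_self h with h | h
    · exact ⟨_, Or.inl rfl, hl h⟩
    · exact ⟨_, Or.inr rfl, hr h⟩
  · rintro hij y (rfl | rfl)
    · exact hl (MF.side_choice_of_ne hij h).1
    · exact hr (MF.side_choice_of_ne hij h).2

theorem Realizes.comp (h₁ : G.Realizes e F) (h₂ : H.Realizes e F') :
    (comp G H).Realizes e fun S M => MF.comp (F S M) (F' S M) := by
  intro S M i s X h
  rw [MF.side_comp] at h
  refine forces_trans ?_ (forces_map (isEmbedding_comp_left (H := H)) (h₁ S M i s _ h))
  rintro _ ⟨t, ht, rfl⟩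
  exact forces_map (isEmbedding_comp_right (G := G)) (h₂ S M i t X ht)

/-- For the player `j` in control, the states from which `j` wins at the new head form a prefixed
point. The other player follows a postfixed point, returning to the head for ever if `j` never
leaves, which is winning by the parity of `N`. -/
theorem Realizes.iter {N : ℕ} (h : G.Realizes e F) (hN : ∀ x n, G.Ω x = some n → n < N)
    (hj : ∀ i, i ≠ j → GoodPrio i N) :
    (iter j N G).Realizes e fun S M => MF.iter j (F S M) := by
  intro S M i s X hs
  let K : OpenGraph P A := OpenGraph.iter j N G
  let root : K.V := (none : Option G.V)
  have hroot : ∀ t, posAt e K (some root) t ∈ inner e K S := fun t => ⟨root, Or.inl ⟨t, rfl⟩⟩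
  have hbody : ∀ t Z, MF.side i (F S M) t Z →
      posAt e K (lift some (some none) G.init) t ∈
        (K.game e M).Forces i (inner e K S) (posAt e K (some root) '' Z) :=
    fun t Z ht => forces_map (isEmbedding_iter (j := j) (N := N)) (h S M i t Z ht)
  by_cases hij : i = j
  · subst hij
    refine MF.mem_of_side_iter_self (Z := {s | Wins e K M i (some root) s X}) hs ?_ ?_
    · intro t ht
      exact forces_of_step (hroot t) (step_of_boolLabel rfl
        (fun _ => ⟨none, Or.inl rfl, Or.inl ⟨t, ht, rfl⟩⟩) (fun h => absurd rfl h))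
    · intro t ht
      refine forces_of_step (hroot t) (step_of_boolLabel rfl
        (fun _ => ⟨_, Or.inr rfl, forces_trans ?_ (hbody t _ ht)⟩) (fun h => absurd rfl h))
      rintro _ ⟨t', ht', rfl⟩
      exact ht'
  · obtain ⟨Y, hsY, hYX, hY⟩ := MF.exists_of_side_iter hij hs
    refine loop_subset_forces (D := posAt e K (some root) '' Y) ?_ ?_ ⟨s, hsY, rfl⟩
    · rintro _ ⟨t, ht, rfl⟩
      refine strictForces_of_step (hroot t) (step_of_boolLabel rfl (fun h => absurd h hij) ?_)
      rintro - y (rfl | rfl)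
      · exact Or.inl (Or.inl ⟨t, hYX ht, rfl⟩)
      · exact forces_trans (fun b hb => Or.inl (Or.inr hb)) (hbody t Y (hY t ht))
    · intro π hπ hfreq
      refine winsInf_of_frequently (hj i hij) (fun n => ?_) (hfreq.mono fun n hn => ?_)
      · obtain ⟨x, ⟨t, hx⟩ | ⟨U, hx⟩⟩ := hπ n
        · rw [hx]
          change (K.Ω x).getD 0 ≤ N
          cases x with
          | none => exact le_rfl
          | some x =>
            change (G.Ω x).getD 0 ≤ N
            cases hΩ : G.Ω x with
            | none => exact Nat.zero_le _
            | some n => exact (hN x n hΩ).le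
        · rw [hx]; exact Nat.zero_le _
      · obtain ⟨t, -, ht⟩ := hn
        rw [← ht]
        rfl

/-- In the closed graph, a play that reaches the exit is decided by the truth value of `e`. -/
theorem Realizes.equivalent (h : G.Realizes e F) {φ : Formula P A}
    (hφ : ∀ (S : Type w) M s, F S M s (M.val e) ↔ s ∈ φ.sem M) :
    PointedSyntaxGraph.Equivalent.{u, v, w} (G.close e) φ := by
  intro S M s
  have key : ∀ i X, (∀ t ∈ X, (G.game e M).owner (posAt e G none t) ≠ i) →
      MF.side i (F S M) s X → posAt e G G.init s ∈ (G.game e M).win i := by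
    intro i X hX hs
    refine mem_win_of_mem_forces (forces_trans (X := posAt e G none '' X) ?_ ?_)
    · rintro _ ⟨t, ht, rfl⟩
      refine forces_of_step trivial ⟨fun ho => absurd ho (hX t ht), ?_⟩
      rintro - (⟨y, t⟩ | ⟨y, U⟩) hc
      · obtain ⟨-, ⟨z, hz, -⟩, -⟩ := hc
        cases hz
      · obtain ⟨-, g, h1 | h1, -⟩ := hc <;> cases h1
    · have := forces_image (ℋ := G.game e M) (I' := Set.univ) id (fun _ _ => trivial)
        (fun _ _ => rfl) (fun _ _ => rfl) (fun _ _ c' => by simp) (h S M i s X hs)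
      rwa [Set.image_id] at this
  have hexit : ∀ t, t ∈ M.val e ↔ (G.game e M).owner (posAt e G none t) = .abelard := by
    intro t
    classical
    change _ ↔ (if t ∈ M.val e then Player.abelard else Player.eloise) = _
    split_ifs with h <;> simp [h]
  rw [← hφ]
  constructor
  · intro hwin
    by_contra hF
    refine not_mem_win_both hwin (key .abelard (M.val e)ᶜ (fun t ht h => ?_) ?_)
    · exact ht ((hexit t).mpr h)
    · change ¬ F S M s (M.val e)ᶜᶜ
      rwa [compl_compl]
  · intro hF
    exact key .eloise (M.val e) (fun t ht h => by rw [(hexit t).mp ht] at h; cases h) hF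

end OpenGraph


/-! ### The graphs of formulas and game terms -/

namespace OpenGraph

variable {P : Type u} {A : Type v} {e : P} {O O' O'' : P → Prop}
  {F F' : ∀ S : Type w, GameModel P A S → MF S} {j : Player}

/-- `G` satisfies the conditions of game logic graphs with exit, has only priorities `≥ k` and only
literals over letters from `O`, and realizes the frame `F`. -/
structure Represents (e : P) (O : P → Prop) (F : ∀ S : Type w, GameModel P A S → MF S) (k : ℕ)
    (G : OpenGraph P A) : Prop where
  isGL : G.IsGL
  le_prio : ∀ x n, G.Ω x = some n → k ≤ n
  letters : ∀ x p, G.L x = .pos p ∨ G.L x = .neg p → O p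
  realizes : G.Realizes e F

/-- The frame `F` is represented by graphs with arbitrarily large priorities. In this way, two
graphs can be combined without renumbering the priorities. -/
def Representable (e : P) (O : P → Prop) (F : ∀ S : Type w, GameModel P A S → MF S) : Prop :=
  ∀ k, ∃ G : OpenGraph P A, G.init ≠ none ∧ G.Represents e O F k

theorem representable_single (lab : Label P A) (hlab : lab.arity ≤ 1)
    (hO : ∀ p, lab = .pos p ∨ lab = .neg p → O p) (hF : (single lab hlab).Realizes e F) :
    Representable (A := A) e O F :=
  fun _ => ⟨single lab hlab, Option.some_ne_none _, isGL_single lab hlab,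
    fun _ _ h => (Option.some_ne_none _ h.symm).elim, fun _ => hO, hF⟩

theorem Representable.exists_represents (h : Representable (A := A) e O F) (k : ℕ) :
    ∃ G : OpenGraph P A, G.Represents e O F k :=
  (h k).imp fun _ h => h.2

theorem not_boolLabel {p : P} :
    ¬ ((boolLabel j : Label P A) = .pos p ∨ (boolLabel j : Label P A) = .neg p) := by
  cases j <;> rintro (h | h) <;> cases h

theorem Representable.choice (h₁ : Representable (A := A) e O F)
    (h₂ : ∀ k, ∃ G : OpenGraph P A, G.Represents e O' F' k)
    (hO : ∀ p, O p → O'' p) (hO' : ∀ p, O' p → O'' p) :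
    Representable (A := A) e O'' fun S M => MF.choice j (F S M) (F' S M) := by
  intro k
  obtain ⟨G, hG, h₁⟩ := h₁ k
  obtain ⟨b, hb⟩ := G.exists_prio_lt
  obtain ⟨H, h₂⟩ := h₂ (max k b)
  refine ⟨OpenGraph.choice j G H hG, Option.some_ne_none _, h₁.isGL.choice h₂.isGL ?_, ?_, ?_,
    h₁.realizes.choice h₂.realizes⟩
  · exact fun x y m n hx hy =>
      (hb x m hx).trans_le ((le_max_right _ _).trans (h₂.le_prio y n hy))
  · rintro (_ | x | x) n hx
    · cases hx
    · exact h₁.le_prio x n hx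
    · exact (le_max_left _ _).trans (h₂.le_prio x n hx)
  · rintro (_ | x | x) p hp
    · exact absurd hp not_boolLabel
    · exact hO p (h₁.letters x p hp)
    · exact hO' p (h₂.letters x p hp)

theorem Representable.comp (h₁ : Representable (A := A) e O F)
    (h₂ : Representable (A := A) e O' F') (hO : ∀ p, O p → O'' p) (hO' : ∀ p, O' p → O'' p) :
    Representable (A := A) e O'' fun S M => MF.comp (F S M) (F' S M) := by
  intro k
  obtain ⟨G, hG, h₁⟩ := h₁ k
  obtain ⟨b, hb⟩ := G.exists_prio_lt
  obtain ⟨H, -, h₂⟩ := h₂ (max k b)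
  obtain ⟨x₀, hx₀⟩ := Option.ne_none_iff_exists'.mp hG
  refine ⟨OpenGraph.comp G H, ?_, h₁.isGL.comp h₂.isGL ?_, ?_, ?_,
    h₁.realizes.comp h₂.realizes⟩
  · change lift Sum.inl _ G.init ≠ none
    rw [hx₀]
    exact Option.some_ne_none _
  · exact fun x y m n hx hy =>
      (hb x m hx).trans_le ((le_max_right _ _).trans (h₂.le_prio y n hy))
  · rintro (x | x) n hx
    · exact h₁.le_prio x n hx
    · exact (le_max_left _ _).trans (h₂.le_prio x n hx)
  · rintro (x | x) p hp
    · exact hO p (h₁.letters x p hp)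
    · exact hO' p (h₂.letters x p hp)

/-- There are arbitrarily large priorities for a head of player `j`. -/
theorem exists_prio (j : Player) (b : ℕ) : ∃ N, b ≤ N ∧
    ((Odd N → j = .eloise) ∧ (Even N → j = .abelard)) ∧ ∀ i, i ≠ j → ParityGame.GoodPrio i N := by
  cases j with
  | eloise =>
    have ho : Odd (2 * b + 1) := ⟨b, rfl⟩
    refine ⟨2 * b + 1, by omega, ⟨fun _ => rfl, fun h => ?_⟩, fun i hi => ?_⟩
    · exact absurd h (Nat.not_even_iff_odd.mpr ho)
    · cases i with
      | eloise => exact absurd rfl hi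
      | abelard => exact ho
  | abelard =>
    have he : Even (2 * b) := ⟨b, by omega⟩
    refine ⟨2 * b, by omega, ⟨fun h => ?_, fun _ => rfl⟩, fun i hi => ?_⟩
    · exact absurd he (Nat.not_even_iff_odd.mpr h)
    · cases i with
      | eloise => exact he
      | abelard => exact absurd rfl hi

theorem Representable.iter (h : Representable (A := A) e O F) :
    Representable (A := A) e O fun S M => MF.iter j (F S M) := by
  intro k
  obtain ⟨G, hG, h⟩ := h k
  obtain ⟨b, hb⟩ := G.exists_prio_lt
  obtain ⟨N, hN, hj, hgood⟩ := exists_prio j (max k b)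
  have hlt : ∀ x n, G.Ω x = some n → n < N := fun x n hx =>
    (hb x n hx).trans_le ((le_max_right _ _).trans hN)
  refine ⟨OpenGraph.iter j N G, Option.some_ne_none _, h.isGL.iter hG hlt hj, ?_, ?_,
    h.realizes.iter hlt hgood⟩
  · rintro (_ | x) n hx
    · obtain rfl := Option.some.inj hx
      exact (le_max_left _ _).trans hN
    · exact h.le_prio x n hx
  · rintro (_ | x) p hp
    · exact absurd hp not_boolLabel
    · exact h.letters x p hp

/-- A test is a choice between a formula and the end of the game. -/
theorem Representable.test (h : Representable (A := A) e O F) :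
    Representable (A := A) e O fun S M => MF.choice j (F S M) MF.unit :=
  h.choice (fun _ => ⟨skip, isGL_skip, fun x => x.elim, fun x => x.elim, realizes_skip⟩)
    (fun _ => id) (O' := O) (fun _ => id)

end OpenGraph

open OpenGraph

variable {P : Type u} {A : Type v}

mutual

/-- A formula is represented as the frame that ignores the set of final states. The letter `e`
only labels the exit, and may occur in the formula. -/
theorem Formula.representable (e : P) : ∀ φ : Formula P A, φ.DNNF →
    Representable (A := A) e (fun p => φ.Occurs p)
      fun (S : Type w) (M : GameModel P A S) => MF.const (φ.sem M)
  | .atom p, _ => by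
    refine representable_single (.pos p) zero_le_one ?_ (realizes_pos p)
    rintro q (h | h) <;> cases h
    rfl
  | .neg φ, h => by
    obtain ⟨p, rfl⟩ := h
    refine representable_single (.neg p) zero_le_one ?_ (realizes_neg p)
    rintro q (h | h) <;> cases h
    rfl
  | .and φ ψ, h =>
    (Formula.representable e φ h.1).choice (j := .abelard)
      (Formula.representable e ψ h.2).exists_represents
      (fun _ => Or.inl) (fun _ => Or.inr)
  | .or φ ψ, h =>
    (Formula.representable e φ h.1).choice (j := .eloise)
      (Formula.representable e ψ h.2).exists_represents
      (fun _ => Or.inl) (fun _ => Or.inr)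
  | .dia α φ, h =>
    (GameTerm.representable e α h.1).comp (Formula.representable e φ h.2)
      (fun _ => Or.inl) (fun _ => Or.inr)

theorem GameTerm.representable (e : P) : ∀ α : GameTerm P A, α.DNNF →
    Representable (A := A) e (fun p => α.Occurs p)
      fun (S : Type w) (M : GameModel P A S) => α.sem M
  | .atom g, _ =>
    representable_single (modalLabel g .eloise) (arity_modalLabel g .eloise).le
      (fun p h => by rcases h with h | h <;> cases h) (realizes_modal g .eloise)
  | .dual α, h => by
    obtain ⟨g, rfl⟩ := h
    exact representable_single (modalLabel g .abelard) (arity_modalLabel g .abelard).le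
      (fun p h => by rcases h with h | h <;> cases h) (realizes_modal g .abelard)
  | .angelChoice α β, h =>
    (GameTerm.representable e α h.1).choice (j := .eloise)
      (GameTerm.representable e β h.2).exists_represents
      (fun _ => Or.inl) (fun _ => Or.inr)
  | .demonChoice α β, h =>
    (GameTerm.representable e α h.1).choice (j := .abelard)
      (GameTerm.representable e β h.2).exists_represents
      (fun _ => Or.inl) (fun _ => Or.inr)
  | .comp α β, h =>
    (GameTerm.representable e α h.1).comp (GameTerm.representable e β h.2)
      (fun _ => Or.inl) (fun _ => Or.inr)
  | .angelIter α, h => (GameTerm.representable e α h).iter (j := .eloise)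
  | .demonIter α, h => (GameTerm.representable e α h).iter (j := .abelard)
  | .angelTest φ, h => (Formula.representable e φ h).test (j := .abelard)
  | .demonTest φ, h => (Formula.representable e φ h).test (j := .eloise)

end

theorem Formula.nonempty_letters : Formula P A → Nonempty P
  | .atom p => ⟨p⟩
  | .neg φ => φ.nonempty_letters
  | .and φ _ => φ.nonempty_letters
  | .or φ _ => φ.nonempty_letters
  | .dia _ φ => φ.nonempty_letters

end GameLogic

theorem mainTheorem2 {P : Type u} {A : Type v} :
    (∀ (α : GameLogic.GameTerm P A) (e : P), α.DNNF → ¬ α.Occurs e →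
      ∃ 𝔾 : GameLogic.PointedSyntaxGraph P A,
        𝔾.IsGameLogicGraphWithExit e ∧
        GameLogic.PointedSyntaxGraph.Equivalent.{u, v, w} 𝔾 (.dia α (.atom e))) ∧
    (∀ φ : GameLogic.Formula P A, φ.DNNF →
      ∃ 𝔾 : GameLogic.PointedSyntaxGraph P A,
        𝔾.IsGameLogicGraph ∧
        GameLogic.PointedSyntaxGraph.Equivalent.{u, v, w} 𝔾 φ) := by
  constructor
  · intro α e hα he
    obtain ⟨G, -, hG⟩ := α.representable e hα 0
    refine ⟨G.close e,
      hG.isGL.isGameLogicGraphWithExit_close e fun x => ⟨fun hx => ?_, fun hx => ?_⟩,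
      hG.realizes.equivalent fun S M s => Iff.rfl⟩
    · exact he (hG.letters x e (Or.inl hx))
    · exact he (hG.letters x e (Or.inr hx))
  · intro φ hφ
    -- The exit cannot be reached in the graph of a formula, so its label does not matter.
    obtain ⟨e⟩ := φ.nonempty_letters
    obtain ⟨G, -, hG⟩ := φ.representable e hφ 0
    exact ⟨G.close e, hG.isGL.isGameLogicGraph_close e,
      hG.realizes.equivalent fun S M s => Iff.rfl⟩
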